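/- **Theorem 4.1.** Let $T>0$, $\mu_0>0$, and let $\Gamma(t)$, $t\in[0,T]$, be a two-dimensional closed (compact, without boundary), connected, oriented surface in $\mathbb{R}^3$ that is smooth and moves smoothly in time, with unit (outward) normal field $\nu(\cdot,t)$ and scalar normal velocity $V_\Gamma^N(\cdot,t)$ in the direction of $\nu$. Put $S_T=\bigcup_{t\in(0,T)}\Gamma(t)\times\{t\}$. Let $\pi(\cdot,t)$ be the closest point mapping onto $\Gamma(t)$ and $d(\cdot,t)$ the signed distance from $\Gamma(t)$ increasing in the direction of $\nu$, both defined near $\Gamma(t)$. For $\varepsilon>0$ let $\Omega_\varepsilon(t)=\{x\in\mathbb{R}^3 \mid \mathrm{dist}(x,\Gamma(t))<\varepsilon\}$, and let $\nu_\varepsilon$ and $V_\varepsilon^N$ be the unit outward normal and the scalar outward normal velocity of $\partial\Omega_\varepsilon(t)$. For all sufficiently small $\varepsilon>0$ let $u=u^\varepsilon$, $p=p^\varepsilon$ be a classical solution, regular up to the boundary, of $$\partial_tu+(u\cdot\nabla)u+\nabla p=\mu_0\Delta u,\qquad \mathrm{div}\,u=0\qquad\text{in }\Omega_\varepsilon(t),\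 t\in(0,T),$$ $$u\cdot\nu_\varepsilon=V_\varepsilon^N,\qquad (I_3-\nu_\varepsilon\otimes\nu_\varepsilon)D(u)\nu_\varepsilon=0\qquad\text{on }\partial\Omega_\varepsilon(t),\ t\in(0,T),$$ where $(\nabla u)_{ij}=\partial_iu_j$ and $D(u)=\frac12\{\nabla u+(\nabla u)^T\}$. Suppose that there are smooth functions $v,v^1,v^2\colon S_T\to\mathbb{R}^3$ and $q,q^1\colon S_T\to\mathbb{R}$, independent of $\varepsilon$, such that in $\Omega_\varepsilon(t)$ $$u(x,t)=v(\pi,t)+d\,v^1(\pi,t)+d^2v^2(\pi,t)+R(d^3),\qquad p(x,t)=q(\pi,t)+d\,q^1(\pi,t)+R(d^2),$$ where $\pi=\pi(x,t)$, $d=d(x,t)$, and $R(d^k)$ stands for a remainder whose space-time derivatives of each order $l<k$ are, at each fixed time $t\in(0,T)$, bounded on $\Omega_\varepsilon(t)$ by $C\varepsilon^{k-l}$ for all small $\varepsilon$, with $C$ independent of $\varepsilon$ and of $x$. Then $v\cdot\nu=V_\Gamma^N$ on $S_T$, and $$\partial^\bullet_vv+\nabla_\Gamma q+q^1\nu=2\mu_0\,\mathrm{div}_\Gamma\bigl(P_\Gamma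 D^{tan}(v)P_\Gamma\bigr),\qquad \mathrm{div}_\Gamma v=0\qquad\text{on }S_T.$$ Here, for functions on $S_T$ and arbitrary smooth extensions $\tilde f$ of them to a neighbourhood, $P_\Gamma=I_3-\nu\otimes\nu$, $\nabla_\Gamma f=P_\Gamma\nabla\tilde f=(\partial_1^{tan}f,\partial_2^{tan}f,\partial_3^{tan}f)$, $(\nabla_\Gamma v)_{ij}=\partial_i^{tan}v_j$, $D^{tan}(v)=\frac12\{\nabla_\Gamma v+(\nabla_\Gamma v)^T\}$, $\mathrm{div}_\Gamma v=\sum_i\partial_i^{tan}v_i$, $[\mathrm{div}_\Gamma M]_j=\sum_i\partial_i^{tan}M_{ij}$ for a matrix field $M$, and $\partial^\bullet_vf=\partial_t\tilde f+v\cdot\nabla\tilde f$ is the material derivative along $v$. -/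

import Mathlib

open Set Filter Topology
open scoped ContDiff Matrix

noncomputable section

namespace ThinNS

/-- Three-dimensional Euclidean space. -/
abbrev E3 := EuclideanSpace ℝ (Fin 3)

/-! ### Differential operators on space-time `ℝ³ × ℝ` -/

/-- The partial derivative `∂ᵢ f` of a function of `(x, t)`. -/
def dx {F : Type*} [NormedAddCommGroup F] [NormedSpace ℝ F]
    (i : Fin 3) (f : E3 × ℝ → F) (z : E3 × ℝ) : F :=
  fderiv ℝ f z (EuclideanSpace.single i 1, 0)

/-- The partial derivative `∂ₜ f` of a function of `(x, t)`. -/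
def dt {F : Type*} [NormedAddCommGroup F] [NormedSpace ℝ F]
    (f : E3 × ℝ → F) (z : E3 × ℝ) : F :=
  fderiv ℝ f z (0, 1)

/-- The spatial gradient `∇ f` of a scalar function. -/
def grad (f : E3 × ℝ → ℝ) (z : E3 × ℝ) : E3 :=
  WithLp.toLp 2 fun i => dx i f z

/-- The spatial gradient matrix `∇ F = (∂ᵢ Fⱼ)ᵢⱼ` of a vector field. -/
def gradMat (F : E3 × ℝ → E3) (z : E3 × ℝ) : Matrix (Fin 3) (Fin 3) ℝ :=
  Matrix.of fun i j => dx i (fun w => F w j) z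

/-- The strain rate tensor `D(u) = (∇ u + (∇ u)ᵀ) / 2`. -/
def strain (u : E3 × ℝ → E3) (z : E3 × ℝ) : Matrix (Fin 3) (Fin 3) ℝ :=
  (1 / 2 : ℝ) • (gradMat u z + (gradMat u z)ᵀ)

/-! ### Moving surfaces and moving domains -/

/-- `Γ(t)`, `t ∈ [0, T]`, is a smoothly moving closed connected surface in `ℝ³`, with continuous
unit normal field `ν` and scalar normal velocity `V` in the direction of `ν`. Near each of its
points, the space-time track of `Γ` is the zero set of a smooth function `φ` with nonvanishing
spatial gradient, and there `ν = ∇φ / |∇φ|` and `V = -∂ₜφ / |∇φ|`. -/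
structure IsMovingClosedSurface (T : ℝ) (Γ : ℝ → Set E3) (ν : E3 × ℝ → E3) (V : E3 × ℝ → ℝ) :
    Prop where
  isCompact : IsCompact {z : E3 × ℝ | z.2 ∈ Icc 0 T ∧ z.1 ∈ Γ z.2}
  isConnected : ∀ t ∈ Icc 0 T, IsConnected (Γ t)
  exists_levelSet : ∀ t ∈ Icc 0 T, ∀ y ∈ Γ t, ∃ (U : Set (E3 × ℝ)) (φ : E3 × ℝ → ℝ),
    IsOpen U ∧ (y, t) ∈ U ∧ ContDiffOn ℝ ∞ φ U ∧ (∀ z ∈ U, grad φ z ≠ 0) ∧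
    (∀ z ∈ U, z.2 ∈ Icc 0 T → (z.1 ∈ Γ z.2 ↔ φ z = 0)) ∧
    (∀ z ∈ U, z.2 ∈ Icc 0 T → z.1 ∈ Γ z.2 →
      ν z = ‖grad φ z‖⁻¹ • grad φ z ∧ V z = -dt φ z / ‖grad φ z‖)

/-- The space-time surface `S_T = ⋃_{t ∈ (0, T)} Γ(t) × {t}`. -/
def spaceTimeSurface (T : ℝ) (Γ : ℝ → Set E3) : Set (E3 × ℝ) :=
  {z | z.2 ∈ Ioo 0 T ∧ z.1 ∈ Γ z.2}

/-- The moving thin domain `Ω_ε(t)`: the points at distance less than `ε` from `Γ(t)`. -/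
def thinDomain (Γ : ℝ → Set E3) (ε t : ℝ) : Set E3 :=
  Metric.thickening ε (Γ t)

/-- At the boundary point `z = (x, t)`, the moving domain `Ω` has unit outward normal `n` and
scalar outward normal velocity `w`: near `z` it is the set `φ < 0` for a smooth `φ` with `φ z = 0`
and nonvanishing spatial gradient, `n = ∇φ / |∇φ|` and `w = -∂ₜφ / |∇φ|`. -/
def HasOutwardNormal (Ω : ℝ → Set E3) (z : E3 × ℝ) (n : E3) (w : ℝ) : Prop :=
  ∃ φ : E3 × ℝ → ℝ, ContDiffAt ℝ ∞ φ z ∧ φ z = 0 ∧ grad φ z ≠ 0 ∧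
    (∀ᶠ y in 𝓝 z, (y.1 ∈ Ω y.2 ↔ φ y < 0)) ∧
    n = ‖grad φ z‖⁻¹ • grad φ z ∧ w = -dt φ z / ‖grad φ z‖

/-- A closest point to `x` in `A`. -/
def closestPoint (A : Set E3) (x : E3) : E3 :=
  Classical.epsilon fun y => y ∈ A ∧ dist x y = Metric.infDist x A

theorem closestPoint_of_mem {A : Set E3} {x : E3} (hx : x ∈ A) : closestPoint A x = x := by
  have h : ∃ y, y ∈ A ∧ dist x y = Metric.infDist x A :=
    ⟨x, hx, by rw [dist_self, Metric.infDist_zero_of_mem hx]⟩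
  have h2 : dist x (closestPoint A x) = Metric.infDist x A := (Classical.epsilon_spec h).2
  exact (dist_eq_zero.mp (h2.trans (Metric.infDist_zero_of_mem hx))).symm

/-- The extension `f(π(x, t), t)` of a function `f` on the space-time surface that is constant in
the normal direction, where `π(·, t)` is the closest point mapping onto `Γ(t)`. -/
def normalExt {F : Type*} (Γ : ℝ → Set E3) (f : E3 × ℝ → F) (z : E3 × ℝ) : F :=
  f (closestPoint (Γ z.2) z.1, z.2)

/-- The signed distance `d(x, t)` from `Γ(t)`, increasing in the direction of `ν`. -/
def signedDist (Γ : ℝ → Set E3) (ν : E3 × ℝ → E3) (z : E3 × ℝ) : ℝ :=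
  Real.sign (inner ℝ (z.1 - closestPoint (Γ z.2) z.1) (normalExt Γ ν z)) *
    Metric.infDist z.1 (Γ z.2)

/-- A function on the space-time surface `S_T` is smooth if it is locally the restriction of a
smooth function of `(x, t)`. -/
def SmoothOnSurface {F : Type*} [NormedAddCommGroup F] [NormedSpace ℝ F]
    (T : ℝ) (Γ : ℝ → Set E3) (f : E3 × ℝ → F) : Prop :=
  ∀ z ∈ spaceTimeSurface T Γ, ∃ g : E3 × ℝ → F, ContDiffAt ℝ ∞ g z ∧
    ∀ᶠ w in 𝓝[spaceTimeSurface T Γ] z, g w = f w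

/-! ### Tangential operators on the moving surface -/

/-- The orthogonal projection `P_Γ = I - ν ⊗ ν` onto the tangent plane. -/
def proj (ν : E3 × ℝ → E3) (z : E3 × ℝ) : Matrix (Fin 3) (Fin 3) ℝ :=
  1 - Matrix.vecMulVec (ν z).ofLp (ν z).ofLp

/-- The tangential derivative `∂ᵢᵗᵃⁿ f = ∑ⱼ (δᵢⱼ - νᵢ νⱼ) ∂ⱼ f̄`, computed with the constant normal
extension `f̄` of `f` (it does not depend on the extension). -/
def tanD (Γ : ℝ → Set E3) (ν : E3 × ℝ → E3) (i : Fin 3) (f : E3 × ℝ → ℝ) (z : E3 × ℝ) : ℝ :=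
  ∑ j, proj ν z i j * dx j (normalExt Γ f) z

/-- The tangential gradient matrix `∇_Γ G = (∂ᵢᵗᵃⁿ Gⱼ)ᵢⱼ`. -/
def surfGradMat (Γ : ℝ → Set E3) (ν : E3 × ℝ → E3) (G : E3 × ℝ → E3) (z : E3 × ℝ) :
    Matrix (Fin 3) (Fin 3) ℝ :=
  Matrix.of fun i j => tanD Γ ν i (fun w => G w j) z

/-- The surface divergence `div_Γ G = ∑ᵢ ∂ᵢᵗᵃⁿ Gᵢ` of a vector field. -/
def surfDiv (Γ : ℝ → Set E3) (ν : E3 × ℝ → E3) (G : E3 × ℝ → E3) (z : E3 × ℝ) : ℝ :=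
  ∑ i, tanD Γ ν i (fun w => G w i) z

/-- The `j`-th component `∑ᵢ ∂ᵢᵗᵃⁿ Mᵢⱼ` of the surface divergence of a matrix field. -/
def surfDivMat (Γ : ℝ → Set E3) (ν : E3 × ℝ → E3)
    (M : E3 × ℝ → Matrix (Fin 3) (Fin 3) ℝ) (j : Fin 3) (z : E3 × ℝ) : ℝ :=
  ∑ i, tanD Γ ν i (fun w => M w i j) z

/-- The tangential strain rate `Dᵗᵃⁿ(v) = (∇_Γ v + (∇_Γ v)ᵀ) / 2`. -/
def tanStrain (Γ : ℝ → Set E3) (ν : E3 × ℝ → E3) (v : E3 × ℝ → E3) (z : E3 × ℝ) :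
    Matrix (Fin 3) (Fin 3) ℝ :=
  (1 / 2 : ℝ) • (surfGradMat Γ ν v z + (surfGradMat Γ ν v z)ᵀ)

/-- The material derivative `∂•_v f = ∂ₜ f̄ + v · ∇ f̄` of a function `f` on the space-time surface,
computed with the constant normal extension `f̄` of `f`. The next theorem says that it is the
derivative of `f` along the trajectories of `v`. -/
def materialDeriv (Γ : ℝ → Set E3) (v : E3 × ℝ → E3) (f : E3 × ℝ → ℝ) (z : E3 × ℝ) : ℝ :=
  dt (normalExt Γ f) z + ∑ i, v z i * dx i (normalExt Γ f) z

theorem hasDerivAt_along_trajectory {Γ : ℝ → Set E3} {v : E3 × ℝ → E3} {f : E3 × ℝ → ℝ}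
    {γ : ℝ → E3} {t : ℝ} (hf : DifferentiableAt ℝ (normalExt Γ f) (γ t, t))
    (hΓ : ∀ᶠ s in 𝓝 t, γ s ∈ Γ s) (hγ : HasDerivAt γ (v (γ t, t)) t) :
    HasDerivAt (fun s => f (γ s, s)) (materialDeriv Γ v f (γ t, t)) t := by
  have h1 : HasDerivAt (fun s => normalExt Γ f (γ s, s))
      (fderiv ℝ (normalExt Γ f) (γ t, t) (v (γ t, t), 1)) t :=
    HasFDerivAt.comp_hasDerivAt (f := fun s => (γ s, s)) t hf.hasFDerivAt
      (hγ.prodMk (hasDerivAt_id t))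
  have h2 : (fun s => f (γ s, s)) =ᶠ[𝓝 t] fun s => normalExt Γ f (γ s, s) := by
    filter_upwards [hΓ] with s hs
    simp only [normalExt, closestPoint_of_mem hs]
  have h3 : ((v (γ t, t), 1) : E3 × ℝ) =
      (0, 1) + ∑ i, v (γ t, t) i • ((EuclideanSpace.single i 1, 0) : E3 × ℝ) := by
    refine Prod.ext ?_ ?_
    · ext j
      simp [Prod.fst_sum, Pi.single_apply]
    · simp [Prod.snd_sum]
  have h4 : fderiv ℝ (normalExt Γ f) (γ t, t) (v (γ t, t), 1) =
      materialDeriv Γ v f (γ t, t) := by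
    rw [h3, map_add, map_sum]
    simp only [map_smul, smul_eq_mul, materialDeriv, dt, dx]
  rw [← h4]
  exact h1.congr_of_eventuallyEq h2

/-! ### The Navier-Stokes equations in the thin domain and expansions in the signed distance -/

/-- `u`, `p` is a classical solution (regular up to the lateral boundary) of the incompressible
Navier-Stokes equations with viscosity `μ₀` and perfect slip Navier boundary conditions in the
moving domain `Ω(t)`, `t ∈ (0, T)`. -/
structure IsNavierStokesSolution (μ₀ T : ℝ) (Ω : ℝ → Set E3) (u : E3 × ℝ → E3) (p : E3 × ℝ → ℝ) :
    Prop where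
  contDiffAt_velocity : ∀ t ∈ Ioo 0 T, ∀ x ∈ closure (Ω t), ContDiffAt ℝ 2 u (x, t)
  contDiffAt_pressure : ∀ t ∈ Ioo 0 T, ∀ x ∈ closure (Ω t), ContDiffAt ℝ 1 p (x, t)
  momentum : ∀ t ∈ Ioo 0 T, ∀ x ∈ Ω t, ∀ j : Fin 3,
    dt (fun w => u w j) (x, t) + ∑ i, u (x, t) i * dx i (fun w => u w j) (x, t) + dx j p (x, t) =
      μ₀ * ∑ i, dx i (dx i fun w => u w j) (x, t)
  divergence_free : ∀ t ∈ Ioo 0 T, ∀ x ∈ Ω t, ∑ i, dx i (fun w => u w i) (x, t) = 0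
  boundary_normal : ∀ t ∈ Ioo 0 T, ∀ x ∈ frontier (Ω t), ∀ (n : E3) (w : ℝ),
    HasOutwardNormal Ω (x, t) n w → inner ℝ (u (x, t)) n = w
  boundary_tangential : ∀ t ∈ Ioo 0 T, ∀ x ∈ frontier (Ω t), ∀ (n : E3) (w : ℝ),
    HasOutwardNormal Ω (x, t) n w →
      (1 - Matrix.vecMulVec n.ofLp n.ofLp) *ᵥ (strain u (x, t) *ᵥ n.ofLp) = 0

/-- The family `R ε` of functions on the thin domains is a remainder of order `k`, written
`R(dᵏ)`: for each time, its space-time derivatives of order `l < k` are `O(ε^(k - l))` on the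
thin domain of width `ε`, as `ε → 0`. -/
def IsRemainder {F : Type*} [NormedAddCommGroup F] [NormedSpace ℝ F]
    (T : ℝ) (Γ : ℝ → Set E3) (k : ℕ) (R : ℝ → E3 × ℝ → F) : Prop :=
  ∀ t ∈ Ioo 0 T, ∃ C : ℝ, ∀ᶠ ε in 𝓝[>] (0 : ℝ), ∀ x ∈ closure (thinDomain Γ ε t),
    ∀ l < k, ‖iteratedFDeriv ℝ l (R ε) (x, t)‖ ≤ C * ε ^ (k - l)

end ThinNS

end

open ThinNS

/-!
On `S_T` the normal derivatives of the limit velocity field `W = v̄ + d v̄¹ + d² v̄²` are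
controlled by the boundary conditions on the single side `y + ε ν` of the thin domain. The outward
normal there is still `ν(y)` and its velocity is `V(y)`, since the signed distance is a defining
function, so impermeability says `W(y + ε ν) · ν - V = O(ε³)`. The Taylor coefficients of order
`0, 1, 2` vanish: `W · ν = V`, `ν · D(W) ν = 0` and `ν · (∂_ν D(W)) ν = 0`. The slip condition,
whose error is only `O(ε²)`, gives `P_Γ D(W) ν = 0` and `P_Γ (∂_ν D(W)) ν = 0` in the same way, so
that `D(W) ν` vanishes together with its first normal derivative.

Hence `D(W) = P_Γ Dᵗᵃⁿ(v) P_Γ` on `S_T`, and since `(∂_ν D(W)) ν = 0` the surface divergence of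
this matrix is the full divergence of `D(W)`, which is `Δ W / 2` because `div W` vanishes on `S_T`
together with its spatial gradient. The bulk equations restricted to `S_T` then become the surface
equations.
-/

namespace ThinNS

/-! ### Retractions along a transversal field -/

section Retraction

variable {E F : Type*} [NormedAddCommGroup E] [NormedSpace ℝ E] [NormedAddCommGroup F]
  [NormedSpace ℝ F]

theorem exists_contDiff_localInverse [CompleteSpace E] {n : WithTop ℕ∞} (hn : n ≠ 0) {f : E → F}
    {f' : E ≃L[ℝ] F} {a : E} (hf : ∀ᶠ x in 𝓝 a, ContDiffAt ℝ n f x)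
    (hf' : HasFDerivAt f (f' : E →L[ℝ] F) a) :
    ∃ g : F → E, (∀ᶠ y in 𝓝 (f a), ContDiffAt ℝ n g y ∧ f (g y) = y) ∧
      ∀ᶠ x in 𝓝 a, g (f x) = x := by
  have hfa : ContDiffAt ℝ n f a := hf.self_of_nhds
  set e := hfa.toOpenPartialHomeomorph f hf' hn
  have hcoe : ⇑e = f := hfa.toOpenPartialHomeomorph_coe hf' hn
  have ha : a ∈ e.source := hfa.mem_toOpenPartialHomeomorph_source hf' hn
  have hfa_mem : f a ∈ e.target := hcoe ▸ e.map_source ha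
  have hequiv : ∀ᶠ x in 𝓝 a, fderiv ℝ f x ∈ range ((↑) : (E ≃L[ℝ] F) → E →L[ℝ] F) := by
    have hcont : ContinuousAt (fderiv ℝ f) a :=
      (hfa.fderiv_right (m := 0)
        (by simpa using ENat.one_le_iff_ne_zero_withTop.mpr hn)).continuousAt
    exact hcont (hf'.fderiv ▸ ContinuousLinearEquiv.nhds f')
  have htendsto : Tendsto e.symm (𝓝 (f a)) (𝓝 a) := by
    have h := (e.continuousAt_symm hfa_mem).tendsto
    rwa [← hcoe, e.left_inv ha, hcoe] at h
  refine ⟨e.symm, ?_, ?_⟩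
  · filter_upwards [htendsto.eventually (hequiv.and hf), e.open_target.mem_nhds hfa_mem]
      with y ⟨⟨g', hg'⟩, hfy⟩ hy
    refine ⟨e.contDiffAt_symm (f₀' := g') hy ?_ (hcoe ▸ hfy), hcoe ▸ e.right_inv hy⟩
    rw [hcoe, hg']
    exact (hfy.differentiableAt hn).hasFDerivAt
  · filter_upwards [e.open_source.mem_nhds ha] with x hx using hcoe ▸ e.left_inv hx

theorem exists_equiv_add_smul_prod (L : E →L[ℝ] ℝ) {x : E} (hx : L x ≠ 0) :
    ∃ e : (E × ℝ) ≃L[ℝ] E × ℝ, ∀ h : E, ∀ s : ℝ, e (h, s) = (h + s • x, L h) := by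
  let A : E × ℝ →L[ℝ] E × ℝ :=
    (.fst ℝ E ℝ + (ContinuousLinearMap.snd ℝ E ℝ).smulRight x).prod (L.comp (.fst ℝ E ℝ))
  let σ : E × ℝ →L[ℝ] ℝ := (L x)⁻¹ • (L.comp (.fst ℝ E ℝ) - .snd ℝ E ℝ)
  let B : E × ℝ →L[ℝ] E × ℝ := (.fst ℝ E ℝ - σ.smulRight x).prod σ
  refine ⟨ContinuousLinearEquiv.equivOfInverse A B ?_ ?_, fun h s => rfl⟩
  · rintro ⟨h, s⟩
    have : (L x)⁻¹ * (s * L x) = s := by field_simp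
    simp [A, B, σ, this]
  · rintro ⟨h, c⟩
    have : (L x)⁻¹ * (L h - c) * L x = L h - c := by field_simp
    simp [A, B, σ, this]

theorem exists_retraction_along [CompleteSpace E] {φ : E → ℝ} {X : E → E} {z₀ : E}
    (hφ : ∀ᶠ z in 𝓝 z₀, ContDiffAt ℝ ∞ φ z) (hX : ∀ᶠ z in 𝓝 z₀, ContDiffAt ℝ ∞ X z)
    (h0 : φ z₀ = 0) (htrans : fderiv ℝ φ z₀ (X z₀) ≠ 0) :
    ∃ P : E → E,
      (∀ᶠ z in 𝓝 z₀, ContDiffAt ℝ ∞ P z ∧ φ (P z) = 0 ∧ ∃ s : ℝ, P z + s • X (P z) = z) ∧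
      ∀ᶠ a in 𝓝 (z₀, (0 : ℝ)), φ a.1 = 0 → P (a.1 + a.2 • X a.1) = a.1 := by
  set Φ : E × ℝ → E × ℝ := fun a => (a.1 + a.2 • X a.1, φ a.1)
  have hΦ₀ : Φ (z₀, 0) = (z₀, 0) := by simp [Φ, h0]
  obtain ⟨e, he⟩ := exists_equiv_add_smul_prod (fderiv ℝ φ z₀) htrans
  have hfst : Tendsto Prod.fst (𝓝 (z₀, (0 : ℝ))) (𝓝 z₀) := continuous_fst.tendsto _
  have hΦ : ∀ᶠ a in 𝓝 (z₀, 0), ContDiffAt ℝ ∞ Φ a := by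
    filter_upwards [hfst.eventually (hφ.and hX)] with a ha
    exact (contDiffAt_fst.add (contDiffAt_snd.smul (ha.2.comp a contDiffAt_fst))).prodMk
      (ha.1.comp a contDiffAt_fst)
  have hΦ' : HasFDerivAt Φ (e : E × ℝ →L[ℝ] E × ℝ) (z₀, 0) := by
    have hfst' : HasFDerivAt Prod.fst (ContinuousLinearMap.fst ℝ E ℝ) (z₀, 0) := hasFDerivAt_fst
    have hdX := (hX.self_of_nhds.differentiableAt (by simp)).hasFDerivAt.comp (z₀, (0 : ℝ)) hfst'
    have hdφ := (hφ.self_of_nhds.differentiableAt (by simp)).hasFDerivAt.comp (z₀, (0 : ℝ)) hfst'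
    refine ((hfst'.add (hasFDerivAt_snd.smul hdX)).prodMk hdφ).congr_fderiv
      (ContinuousLinearMap.ext fun a => ?_)
    simp [he]
  obtain ⟨G, hG, hGΦ⟩ := exists_contDiff_localInverse (by simp) hΦ hΦ'
  rw [hΦ₀] at hG
  have hι : Tendsto (fun z : E => (z, (0 : ℝ))) (𝓝 z₀) (𝓝 (z₀, 0)) :=
    Continuous.tendsto (by fun_prop) z₀
  refine ⟨fun z => (G (z, 0)).1, ?_, ?_⟩
  · filter_upwards [hι.eventually hG] with z ⟨hGz, hΦG⟩
    obtain ⟨hz, hφz⟩ := Prod.ext_iff.mp hΦG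
    exact ⟨contDiffAt_fst.comp z (hGz.comp z (contDiffAt_id.prodMk contDiffAt_const)), hφz, _, hz⟩
  · filter_upwards [hGΦ] with a ha hφa
    simpa [Φ, hφa] using congrArg Prod.fst ha

end Retraction

/-! ### Lagrange multipliers -/

theorem exists_smul_eq_sub_of_isLocalMinOn {E : Type*} [NormedAddCommGroup E]
    [InnerProductSpace ℝ E] [CompleteSpace E] {ψ : E → ℝ} {x y g : E}
    (hψ : HasStrictFDerivAt ψ (innerSL ℝ g) y) (hg : g ≠ 0)
    (hmin : IsLocalMinOn (fun w => ‖x - w‖ ^ 2) {w | ψ w = ψ y} y) : ∃ c : ℝ, c • g = x - y := by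
  have hdist : HasStrictFDerivAt (fun w => ‖x - w‖ ^ 2)
      (2 • (innerSL ℝ (x - y)).comp (-ContinuousLinearMap.id ℝ E)) y :=
    (hasStrictFDerivAt_norm_sq (x - y)).comp y ((hasStrictFDerivAt_id y).const_sub x)
  obtain ⟨a, b, hab, h⟩ :=
    IsLocalExtrOn.exists_multipliers_of_hasStrictFDerivAt_1d (Or.inl hmin) hψ hdist
  have hmult : a • g = (2 * b) • (x - y) := by
    refine ext_inner_right ℝ fun w => ?_
    have hw := congrArg (fun L => L w) h
    simp only [add_apply, smul_apply, ContinuousLinearMap.comp_apply, neg_apply,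
      innerSL_apply_apply, ContinuousLinearMap.id_apply, inner_neg_right, smul_eq_mul,
      nsmul_eq_mul, zero_apply] at hw
    rw [real_inner_smul_left, real_inner_smul_left]
    push_cast at hw
    linarith
  have hb : b ≠ 0 := by
    rintro rfl
    have ha : a = 0 := by simpa [hg] using hmult
    exact hab (by rw [ha, Prod.mk_zero_zero])
  exact ⟨a / (2 * b), by rw [div_eq_inv_mul, mul_smul, hmult, inv_smul_smul₀ (by simpa using hb)]⟩

/-! ### Defining functions of the moving surface -/

theorem fderiv_apply_eq_sum {F : Type*} [NormedAddCommGroup F] [NormedSpace ℝ F]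
    (f : E3 × ℝ → F) (z : E3 × ℝ) (h : E3) (k : ℝ) :
    fderiv ℝ f z (h, k) = ∑ i, h i • dx i f z + k • dt f z := by
  have hsum : ((h, k) : E3 × ℝ) =
      ∑ i, h i • (EuclideanSpace.single i 1, 0) + k • (0, 1) := by
    refine Prod.ext ?_ (by simp [Prod.snd_sum])
    ext j
    simp [Prod.fst_sum, Pi.single_apply]
  rw [hsum, map_add, map_sum]
  simp only [map_smul, dx, dt]

theorem fderiv_apply_eq_inner_grad (φ : E3 × ℝ → ℝ) (z : E3 × ℝ) (h : E3) (k : ℝ) :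
    fderiv ℝ φ z (h, k) = inner ℝ (grad φ z) h + k * dt φ z := by
  simp [fderiv_apply_eq_sum, grad, PiLp.inner_apply]

theorem contDiffAt_grad {φ : E3 × ℝ → ℝ} {z : E3 × ℝ} (hφ : ContDiffAt ℝ ∞ φ z) :
    ContDiffAt ℝ ∞ (grad φ) z :=
  contDiffAt_euclidean.mpr fun _ => (hφ.fderiv_right (m := ∞) (by simp)).clm_apply contDiffAt_const

/-- The unit normal field `∇φ / |∇φ|` of the level sets of `φ`; it is `0` where `∇φ = 0`. -/
noncomputable def unitGrad (φ : E3 × ℝ → ℝ) (z : E3 × ℝ) : E3 := ‖grad φ z‖⁻¹ • grad φ z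

theorem norm_unitGrad {φ : E3 × ℝ → ℝ} {z : E3 × ℝ} (hg : grad φ z ≠ 0) : ‖unitGrad φ z‖ = 1 :=
  norm_smul_inv_norm hg

theorem contDiffAt_unitGrad {φ : E3 × ℝ → ℝ} {z : E3 × ℝ} (hφ : ContDiffAt ℝ ∞ φ z)
    (hg : grad φ z ≠ 0) : ContDiffAt ℝ ∞ (unitGrad φ) z :=
  (((contDiffAt_grad hφ).norm ℝ hg).inv (norm_ne_zero_iff.mpr hg)).smul (contDiffAt_grad hφ)

/-- In the open set `U`, the space-time hypersurface `S` is the zero set of the smooth function `φ`,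
which has nonvanishing spatial gradient, and `ν` and `V` are the unit normal and the normal velocity
of `S` that `φ` determines. -/
structure IsLocalDefiningFunction (S : Set (E3 × ℝ)) (ν : E3 × ℝ → E3) (V : E3 × ℝ → ℝ)
    (U : Set (E3 × ℝ)) (φ : E3 × ℝ → ℝ) : Prop where
  isOpen : IsOpen U
  contDiffOn : ContDiffOn ℝ ∞ φ U
  grad_ne_zero : ∀ z ∈ U, grad φ z ≠ 0
  mem_iff : ∀ z ∈ U, z ∈ S ↔ φ z = 0
  normal_eq : ∀ z ∈ U, z ∈ S → ν z = unitGrad φ z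
  velocity_eq : ∀ z ∈ U, z ∈ S → V z = -dt φ z / ‖grad φ z‖

namespace IsLocalDefiningFunction

variable {S U : Set (E3 × ℝ)} {ν : E3 × ℝ → E3} {V φ : E3 × ℝ → ℝ} {z : E3 × ℝ}

theorem contDiffAt (hφ : IsLocalDefiningFunction S ν V U φ) (hz : z ∈ U) : ContDiffAt ℝ ∞ φ z :=
  hφ.contDiffOn.contDiffAt (hφ.isOpen.mem_nhds hz)

theorem contDiffAt_unitGrad (hφ : IsLocalDefiningFunction S ν V U φ) (hz : z ∈ U) :
    ContDiffAt ℝ ∞ (unitGrad φ) z :=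
  ThinNS.contDiffAt_unitGrad (hφ.contDiffAt hz) (hφ.grad_ne_zero z hz)

theorem fderiv_apply (hφ : IsLocalDefiningFunction S ν V U φ) (hzU : z ∈ U) (hzS : z ∈ S)
    (h : E3) (k : ℝ) : fderiv ℝ φ z (h, k) = ‖grad φ z‖ * (inner ℝ (ν z) h - V z * k) := by
  have hpos : ‖grad φ z‖ ≠ 0 := norm_ne_zero_iff.mpr (hφ.grad_ne_zero z hzU)
  rw [fderiv_apply_eq_inner_grad, hφ.normal_eq z hzU hzS, hφ.velocity_eq z hzU hzS, unitGrad,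
    real_inner_smul_left]
  field_simp
  ring

theorem norm_normal (hφ : IsLocalDefiningFunction S ν V U φ) (hzU : z ∈ U) (hzS : z ∈ S) :
    ‖ν z‖ = 1 := by
  rw [hφ.normal_eq z hzU hzS, norm_unitGrad (hφ.grad_ne_zero z hzU)]

theorem fderiv_normal (hφ : IsLocalDefiningFunction S ν V U φ) (hzU : z ∈ U) (hzS : z ∈ S) :
    fderiv ℝ φ z (ν z, 0) = ‖grad φ z‖ := by
  rw [hφ.fderiv_apply hzU hzS, real_inner_self_eq_norm_sq, hφ.norm_normal hzU hzS]
  ring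

end IsLocalDefiningFunction

/-! ### The closest point mapping -/

theorem sign_mul_abs_self (r : ℝ) : Real.sign r * |r| = r := by
  rcases lt_trichotomy r 0 with hr | rfl | hr
  · rw [Real.sign_of_neg hr, abs_of_neg hr, neg_one_mul, neg_neg]
  · simp
  · rw [Real.sign_of_pos hr, abs_of_pos hr, one_mul]

/-- The closest point mapping `(x, t) ↦ (π(x, t), t)` of space-time onto the moving surface, so that
`normalExt Γ f` is `f ∘ closestPointMap Γ`. -/
noncomputable def closestPointMap (Γ : ℝ → Set E3) (z : E3 × ℝ) : E3 × ℝ :=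
  (closestPoint (Γ z.2) z.1, z.2)

/-- The point `(x + r ν(x, t), t)` of the normal line through `z = (x, t)`. -/
noncomputable def normalLine (ν : E3 × ℝ → E3) (z : E3 × ℝ) (r : ℝ) : E3 × ℝ :=
  (z.1 + r • ν z, z.2)

theorem normalLine_eq_add_smul (ν : E3 × ℝ → E3) (z : E3 × ℝ) (r : ℝ) :
    normalLine ν z r = z + r • (ν z, 0) := by
  simp [normalLine, Prod.ext_iff]

theorem normalLine_zero (ν : E3 × ℝ → E3) (z : E3 × ℝ) : normalLine ν z 0 = z := by
  simp [normalLine]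

theorem hasDerivAt_normalLine (ν : E3 × ℝ → E3) (z : E3 × ℝ) (r : ℝ) :
    HasDerivAt (normalLine ν z) (ν z, 0) r := by
  have h := ((hasDerivAt_id r).smul_const ((ν z, 0) : E3 × ℝ)).const_add z
  rw [one_smul] at h
  exact h.congr_of_eventuallyEq (.of_forall (normalLine_eq_add_smul ν z))

theorem tendsto_normalLine (ν : E3 × ℝ → E3) (z : E3 × ℝ) :
    Tendsto (normalLine ν z) (𝓝 0) (𝓝 z) := by
  simpa only [normalLine_zero] using (hasDerivAt_normalLine ν z 0).continuousAt.tendsto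

variable {T : ℝ} {Γ : ℝ → Set E3} {ν : E3 × ℝ → E3} {V : E3 × ℝ → ℝ} {z z₀ : E3 × ℝ}

theorem closestPointMap_of_mem (hz : z ∈ spaceTimeSurface T Γ) : closestPointMap Γ z = z := by
  rw [closestPointMap, closestPoint_of_mem hz.2]

theorem normalExt_of_mem {F : Type*} (f : E3 × ℝ → F) (hz : z ∈ spaceTimeSurface T Γ) :
    normalExt Γ f z = f z :=
  congrArg f (closestPointMap_of_mem hz)

theorem eventually_time_mem (hz : z.2 ∈ Ioo 0 T) : ∀ᶠ w in 𝓝 z, w.2 ∈ Ioo 0 T :=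
  continuous_snd.continuousAt.eventually (isOpen_Ioo.mem_nhds hz)

namespace IsMovingClosedSurface

theorem isCompact_slice (hΓ : IsMovingClosedSurface T Γ ν V) {t : ℝ} (ht : t ∈ Icc 0 T) :
    IsCompact (Γ t) := by
  have himage : Γ t =
      Prod.fst '' ({z : E3 × ℝ | z.2 ∈ Icc 0 T ∧ z.1 ∈ Γ z.2} ∩ {z | z.2 = t}) := by
    ext x
    constructor
    · exact fun hx => ⟨(x, t), ⟨⟨ht, hx⟩, rfl⟩, rfl⟩
    · rintro ⟨⟨x, t⟩, ⟨⟨-, hx⟩, rfl⟩, rfl⟩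
      exact hx
  rw [himage]
  exact (hΓ.isCompact.inter_right (isClosed_eq continuous_snd continuous_const)).image
    continuous_fst

theorem nonempty_slice (hΓ : IsMovingClosedSurface T Γ ν V) (hz : z.2 ∈ Ioo 0 T) :
    (Γ z.2).Nonempty :=
  (hΓ.isConnected _ (Ioo_subset_Icc_self hz)).nonempty

theorem closestPoint_spec (hΓ : IsMovingClosedSurface T Γ ν V) (hz : z.2 ∈ Ioo 0 T) :
    closestPoint (Γ z.2) z.1 ∈ Γ z.2 ∧
      dist z.1 (closestPoint (Γ z.2) z.1) = Metric.infDist z.1 (Γ z.2) := by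
  obtain ⟨y, hy, hdist⟩ := (hΓ.isCompact_slice (Ioo_subset_Icc_self hz)).exists_infDist_eq_dist
    (hΓ.nonempty_slice hz) z.1
  exact Classical.epsilon_spec
    (p := fun y => y ∈ Γ z.2 ∧ dist z.1 y = Metric.infDist z.1 (Γ z.2)) ⟨y, hy, hdist.symm⟩

theorem closestPointMap_mem (hΓ : IsMovingClosedSurface T Γ ν V) (hz : z.2 ∈ Ioo 0 T) :
    closestPointMap Γ z ∈ spaceTimeSurface T Γ :=
  ⟨hz, (hΓ.closestPoint_spec hz).1⟩

theorem dist_closestPointMap (hΓ : IsMovingClosedSurface T Γ ν V) (hz : z.2 ∈ Ioo 0 T) :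
    dist z.1 (closestPointMap Γ z).1 = Metric.infDist z.1 (Γ z.2) :=
  (hΓ.closestPoint_spec hz).2

theorem exists_localDefiningFunction (hΓ : IsMovingClosedSurface T Γ ν V)
    (hz : z ∈ spaceTimeSurface T Γ) :
    ∃ U φ, z ∈ U ∧ IsLocalDefiningFunction (spaceTimeSurface T Γ) ν V U φ := by
  obtain ⟨U, φ, hU, hzU, hφ, hgrad, hlevel, hnormal⟩ :=
    hΓ.exists_levelSet z.2 (Ioo_subset_Icc_self hz.1) z.1 hz.2
  refine ⟨U ∩ {w | w.2 ∈ Ioo 0 T}, φ, ⟨hzU, hz.1⟩, ?_⟩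
  have hIcc : ∀ w ∈ U ∩ {w | w.2 ∈ Ioo 0 T}, w.2 ∈ Icc 0 T := fun w hw =>
    Ioo_subset_Icc_self hw.2
  exact
    { isOpen := hU.inter (isOpen_Ioo.preimage continuous_snd)
      contDiffOn := hφ.mono inter_subset_left
      grad_ne_zero := fun w hw => hgrad w hw.1
      mem_iff := fun w hw => (and_iff_right hw.2).trans (hlevel w hw.1 (hIcc w hw))
      normal_eq := fun w hw hwS => (hnormal w hw.1 (hIcc w hw) hwS.2).1
      velocity_eq := fun w hw hwS => (hnormal w hw.1 (hIcc w hw) hwS.2).2 }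

theorem norm_normal (hΓ : IsMovingClosedSurface T Γ ν V) (hz : z ∈ spaceTimeSurface T Γ) :
    ‖ν z‖ = 1 := by
  obtain ⟨U, φ, hzU, hφ⟩ := hΓ.exists_localDefiningFunction hz
  exact hφ.norm_normal hzU hz

theorem inner_normal_self (hΓ : IsMovingClosedSurface T Γ ν V) (hz : z ∈ spaceTimeSurface T Γ) :
    inner ℝ (ν z) (ν z) = 1 := by
  rw [real_inner_self_eq_norm_sq, hΓ.norm_normal hz, one_pow]

theorem smoothOnSurface_normal (hΓ : IsMovingClosedSurface T Γ ν V) : SmoothOnSurface T Γ ν := by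
  intro z hz
  obtain ⟨U, φ, hzU, hφ⟩ := hΓ.exists_localDefiningFunction hz
  refine ⟨unitGrad φ, hφ.contDiffAt_unitGrad hzU, ?_⟩
  filter_upwards [self_mem_nhdsWithin, mem_nhdsWithin_of_mem_nhds (hφ.isOpen.mem_nhds hzU)]
    with w hwS hwU using (hφ.normal_eq w hwU hwS).symm

theorem exists_smul_normal_eq_sub (hΓ : IsMovingClosedSurface T Γ ν V) (hz : z.2 ∈ Ioo 0 T) :
    ∃ c : ℝ, c • normalExt Γ ν z = z.1 - (closestPointMap Γ z).1 := by
  set y := closestPointMap Γ z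
  have hyS : y ∈ spaceTimeSurface T Γ := hΓ.closestPointMap_mem hz
  obtain ⟨U, φ, hyU, hφ⟩ := hΓ.exists_localDefiningFunction hyS
  have hψ : HasStrictFDerivAt (fun x => φ (x, z.2)) (innerSL ℝ (grad φ y)) y.1 := by
    have hslice : HasStrictFDerivAt (fun x : E3 => (x, z.2)) (.inl ℝ E3 ℝ) y.1 :=
      (hasStrictFDerivAt_id _).prodMk (hasStrictFDerivAt_const _ _)
    refine (HasStrictFDerivAt.comp (g := φ) y.1
      ((hφ.contDiffAt hyU).hasStrictFDerivAt (by simp)) hslice).congr_fderiv ?_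
    refine ContinuousLinearMap.ext fun h => ?_
    exact (fderiv_apply_eq_inner_grad φ y h 0).trans (by simp)
  have hmin : IsLocalMinOn (fun x => ‖z.1 - x‖ ^ 2) {x | φ (x, z.2) = φ (y.1, z.2)} y.1 := by
    have hU : ∀ᶠ x in 𝓝 y.1, (x, z.2) ∈ U :=
      (show Continuous fun x : E3 => (x, z.2) by fun_prop).continuousAt.eventually
        (hφ.isOpen.mem_nhds hyU)
    rw [IsLocalMinOn, IsMinFilter, eventually_nhdsWithin_iff]
    filter_upwards [hU] with x hxU hx
    have hxS : (x, z.2) ∈ spaceTimeSurface T Γ :=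
      (hφ.mem_iff _ hxU).mpr (hx.trans ((hφ.mem_iff _ hyU).mp hyS))
    rw [← dist_eq_norm, ← dist_eq_norm, hΓ.dist_closestPointMap hz]
    gcongr
    · exact Metric.infDist_nonneg
    · exact Metric.infDist_le_dist_of_mem hxS.2
  obtain ⟨c, hc⟩ := exists_smul_eq_sub_of_isLocalMinOn hψ (hφ.grad_ne_zero y hyU) hmin
  refine ⟨c * ‖grad φ y‖, ?_⟩
  have hne : ‖grad φ y‖ ≠ 0 := norm_ne_zero_iff.mpr (hφ.grad_ne_zero y hyU)
  change _ • ν y = _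
  rw [hφ.normal_eq y hyU hyS, unitGrad, smul_smul, mul_inv_cancel_right₀ hne, hc]

theorem signedDist_eq_inner (hΓ : IsMovingClosedSurface T Γ ν V) (hz : z.2 ∈ Ioo 0 T) :
    signedDist Γ ν z = inner ℝ (z.1 - (closestPointMap Γ z).1) (normalExt Γ ν z) := by
  obtain ⟨c, hc⟩ := hΓ.exists_smul_normal_eq_sub hz
  have hS := hΓ.closestPointMap_mem hz
  have hinner : inner ℝ (z.1 - (closestPointMap Γ z).1) (normalExt Γ ν z) = c := by
    rw [← hc, real_inner_smul_left]
    exact (congrArg _ (hΓ.inner_normal_self hS)).trans (mul_one c)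
  have hdist : Metric.infDist z.1 (Γ z.2) = |c| := by
    rw [← hΓ.dist_closestPointMap hz, dist_eq_norm, ← hc, norm_smul, Real.norm_eq_abs]
    exact (congrArg _ (hΓ.norm_normal hS)).trans (mul_one _)
  rw [signedDist, hdist, hinner]
  exact (congrArg (fun s => Real.sign s * |c|) hinner).trans (sign_mul_abs_self c)

theorem signedDist_smul_normal (hΓ : IsMovingClosedSurface T Γ ν V) (hz : z.2 ∈ Ioo 0 T) :
    signedDist Γ ν z • normalExt Γ ν z = z.1 - (closestPointMap Γ z).1 := by
  obtain ⟨c, hc⟩ := hΓ.exists_smul_normal_eq_sub hz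
  have hunit : inner ℝ (normalExt Γ ν z) (normalExt Γ ν z) = (1 : ℝ) :=
    hΓ.inner_normal_self (hΓ.closestPointMap_mem hz)
  rw [hΓ.signedDist_eq_inner hz, ← hc, real_inner_smul_left, hunit, mul_one]

theorem abs_signedDist (hΓ : IsMovingClosedSurface T Γ ν V) (hz : z.2 ∈ Ioo 0 T) :
    |signedDist Γ ν z| = Metric.infDist z.1 (Γ z.2) := by
  have hunit : ‖normalExt Γ ν z‖ = 1 := hΓ.norm_normal (hΓ.closestPointMap_mem hz)
  rw [← hΓ.dist_closestPointMap hz, dist_eq_norm, ← hΓ.signedDist_smul_normal hz, norm_smul, hunit,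
    mul_one, Real.norm_eq_abs]

theorem normalLine_closestPointMap (hΓ : IsMovingClosedSurface T Γ ν V) (hz : z.2 ∈ Ioo 0 T) :
    normalLine ν (closestPointMap Γ z) (signedDist Γ ν z) = z :=
  Prod.ext (add_eq_of_eq_sub' (hΓ.signedDist_smul_normal hz)) rfl

theorem signedDist_of_mem (hΓ : IsMovingClosedSurface T Γ ν V) (hz : z ∈ spaceTimeSurface T Γ) :
    signedDist Γ ν z = 0 := by
  rw [← abs_eq_zero, hΓ.abs_signedDist hz.1, Metric.infDist_zero_of_mem hz.2]

/-! ### The tubular neighbourhood -/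

theorem exists_retraction (hΓ : IsMovingClosedSurface T Γ ν V) (hz₀ : z₀ ∈ spaceTimeSurface T Γ) :
    ∃ P : E3 × ℝ → E3 × ℝ,
      (∀ᶠ z in 𝓝 z₀, ContDiffAt ℝ ∞ P z ∧ P z ∈ spaceTimeSurface T Γ ∧ (P z).2 = z.2) ∧
      ∀ᶠ a in 𝓝 (z₀, (0 : ℝ)), a.1 ∈ spaceTimeSurface T Γ → P (normalLine ν a.1 a.2) = a.1 := by
  obtain ⟨U, φ, hzU, hφ⟩ := hΓ.exists_localDefiningFunction hz₀
  have hU : ∀ᶠ z in 𝓝 z₀, z ∈ U := hφ.isOpen.mem_nhds hzU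
  have htrans : fderiv ℝ φ z₀ (unitGrad φ z₀, 0) ≠ 0 := by
    rw [← hφ.normal_eq z₀ hzU hz₀, hφ.fderiv_normal hzU hz₀]
    exact norm_ne_zero_iff.mpr (hφ.grad_ne_zero z₀ hzU)
  obtain ⟨P, hP, hline⟩ := exists_retraction_along (X := fun z => (unitGrad φ z, 0))
    (hU.mono fun z hz => hφ.contDiffAt hz)
    (hU.mono fun z hz => (hφ.contDiffAt_unitGrad hz).prodMk contDiffAt_const)
    ((hφ.mem_iff z₀ hzU).mp hz₀) htrans
  have hline' : ∀ᶠ a in 𝓝 (z₀, (0 : ℝ)), a.1 ∈ spaceTimeSurface T Γ →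
      P (normalLine ν a.1 a.2) = a.1 := by
    filter_upwards [hline, (continuous_fst.tendsto (z₀, (0 : ℝ))).eventually hU] with a ha haU haS
    rw [normalLine_eq_add_smul, hφ.normal_eq _ haU haS, ha ((hφ.mem_iff _ haU).mp haS)]
  have hPz₀ : P z₀ = z₀ := by simpa only [normalLine_zero] using hline'.self_of_nhds hz₀
  have hPU : ∀ᶠ z in 𝓝 z₀, P z ∈ U := by
    refine hP.self_of_nhds.1.continuousAt.eventually ?_
    rwa [hPz₀]
  refine ⟨P, ?_, hline'⟩
  filter_upwards [hP, hPU] with z ⟨hsmooth, hzero, s, hs⟩ hPzU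
  exact ⟨hsmooth, (hφ.mem_iff _ hPzU).mpr hzero, by simpa using congrArg Prod.snd hs⟩

theorem tendsto_closestPointMap (hΓ : IsMovingClosedSurface T Γ ν V)
    (hz₀ : z₀ ∈ spaceTimeSurface T Γ) : Tendsto (closestPointMap Γ) (𝓝 z₀) (𝓝 z₀) := by
  obtain ⟨P, hP, hline⟩ := hΓ.exists_retraction hz₀
  have hPz₀ : P z₀ = z₀ := by simpa only [normalLine_zero] using hline.self_of_nhds hz₀
  have hPcont : Tendsto P (𝓝 z₀) (𝓝 z₀) := by
    simpa only [ContinuousAt, hPz₀] using hP.self_of_nhds.1.continuousAt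
  have hfst : Tendsto Prod.fst (𝓝 z₀) (𝓝 z₀.1) := continuous_fst.tendsto _
  have hdist : Tendsto (fun z => dist z.1 (closestPointMap Γ z).1) (𝓝 z₀) (𝓝 0) := by
    have hbound : Tendsto (fun z => dist z.1 (P z).1) (𝓝 z₀) (𝓝 0) := by
      simpa using hfst.dist ((continuous_fst.tendsto _).comp hPcont)
    refine squeeze_zero' (.of_forall fun _ => dist_nonneg) ?_ hbound
    filter_upwards [hP, eventually_time_mem hz₀.1] with z ⟨_, hPS, hPt⟩ hz
    rw [hΓ.dist_closestPointMap hz]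
    exact Metric.infDist_le_dist_of_mem (hPt ▸ hPS.2)
  have hfoot : Tendsto (fun z => (closestPointMap Γ z).1) (𝓝 z₀) (𝓝 z₀.1) :=
    hfst.congr_dist hdist
  exact hfoot.prodMk_nhds (continuous_snd.tendsto z₀)

theorem tendsto_signedDist (hΓ : IsMovingClosedSurface T Γ ν V)
    (hz₀ : z₀ ∈ spaceTimeSurface T Γ) : Tendsto (signedDist Γ ν) (𝓝 z₀) (𝓝 0) := by
  have hdist : Tendsto (fun z => dist z.1 (closestPointMap Γ z).1) (𝓝 z₀) (𝓝 0) := by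
    simpa using (continuous_fst.tendsto z₀).dist
      ((continuous_fst.tendsto z₀).comp (hΓ.tendsto_closestPointMap hz₀))
  rw [tendsto_zero_iff_abs_tendsto_zero]
  refine hdist.congr' ?_
  filter_upwards [eventually_time_mem hz₀.1] with z hz
  rw [Function.comp_apply, hΓ.abs_signedDist hz, hΓ.dist_closestPointMap hz]

theorem eventuallyEq_closestPointMap (hΓ : IsMovingClosedSurface T Γ ν V)
    (hz₀ : z₀ ∈ spaceTimeSurface T Γ) {P : E3 × ℝ → E3 × ℝ}
    (hP : ∀ᶠ a in 𝓝 (z₀, (0 : ℝ)), a.1 ∈ spaceTimeSurface T Γ →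
      P (normalLine ν a.1 a.2) = a.1) : closestPointMap Γ =ᶠ[𝓝 z₀] P := by
  have hcoords : Tendsto (fun z => (closestPointMap Γ z, signedDist Γ ν z)) (𝓝 z₀) (𝓝 (z₀, 0)) :=
    (hΓ.tendsto_closestPointMap hz₀).prodMk_nhds (hΓ.tendsto_signedDist hz₀)
  filter_upwards [hcoords.eventually hP, eventually_time_mem hz₀.1] with z hPz hz
  have h := hPz (hΓ.closestPointMap_mem hz)
  rwa [hΓ.normalLine_closestPointMap hz, eq_comm] at h

theorem eventually_contDiffAt_closestPointMap (hΓ : IsMovingClosedSurface T Γ ν V)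
    (hz₀ : z₀ ∈ spaceTimeSurface T Γ) :
    ∀ᶠ z in 𝓝 z₀, ContDiffAt ℝ ∞ (closestPointMap Γ) z := by
  obtain ⟨P, hP, hline⟩ := hΓ.exists_retraction hz₀
  filter_upwards [hP, (hΓ.eventuallyEq_closestPointMap hz₀ hline).eventually_nhds] with z hPz heq
  exact hPz.1.congr_of_eventuallyEq heq

theorem eventually_closestPointMap_normalLine (hΓ : IsMovingClosedSurface T Γ ν V)
    (hz₀ : z₀ ∈ spaceTimeSurface T Γ) :
    ∀ᶠ r in 𝓝 (0 : ℝ), closestPointMap Γ (normalLine ν z₀ r) = z₀ := by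
  obtain ⟨P, -, hline⟩ := hΓ.exists_retraction hz₀
  have hpair : Tendsto (fun r : ℝ => (z₀, r)) (𝓝 0) (𝓝 (z₀, 0)) :=
    tendsto_const_nhds.prodMk_nhds tendsto_id
  filter_upwards [hpair.eventually hline,
    (tendsto_normalLine ν z₀).eventually (hΓ.eventuallyEq_closestPointMap hz₀ hline)] with r hr heq
  rw [heq, hr hz₀]

theorem signedDist_normalLine (hΓ : IsMovingClosedSurface T Γ ν V)
    (hz₀ : z₀ ∈ spaceTimeSurface T Γ) {r : ℝ}
    (hr : closestPointMap Γ (normalLine ν z₀ r) = z₀) :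
    signedDist Γ ν (normalLine ν z₀ r) = r := by
  have hν : normalExt Γ ν (normalLine ν z₀ r) = ν z₀ := congrArg ν hr
  rw [hΓ.signedDist_eq_inner (z := normalLine ν z₀ r) hz₀.1, hr, hν, normalLine,
    add_sub_cancel_left, real_inner_smul_left, hΓ.inner_normal_self hz₀, mul_one]

theorem contDiffAt_normalExt {F : Type*} [NormedAddCommGroup F] [NormedSpace ℝ F]
    {f : E3 × ℝ → F} (hΓ : IsMovingClosedSurface T Γ ν V) (hz : z.2 ∈ Ioo 0 T)
    (hπ : ContDiffAt ℝ ∞ (closestPointMap Γ) z) (hf : SmoothOnSurface T Γ f) :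
    ContDiffAt ℝ ∞ (normalExt Γ f) z := by
  obtain ⟨g, hg, hgf⟩ := hf _ (hΓ.closestPointMap_mem hz)
  have hπS : Tendsto (closestPointMap Γ) (𝓝 z)
      (𝓝[spaceTimeSurface T Γ] (closestPointMap Γ z)) :=
    tendsto_nhdsWithin_iff.mpr ⟨hπ.continuousAt,
      (eventually_time_mem hz).mono fun w hw => hΓ.closestPointMap_mem hw⟩
  refine (hg.comp z hπ).congr_of_eventuallyEq ?_
  filter_upwards [hπS.eventually hgf] with w hw using hw.symm

theorem contDiffAt_signedDist (hΓ : IsMovingClosedSurface T Γ ν V) (hz : z.2 ∈ Ioo 0 T)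
    (hπ : ContDiffAt ℝ ∞ (closestPointMap Γ) z) : ContDiffAt ℝ ∞ (signedDist Γ ν) z := by
  refine ((contDiffAt_fst.sub (contDiffAt_fst.comp z hπ)).inner ℝ
    (hΓ.contDiffAt_normalExt hz hπ hΓ.smoothOnSurface_normal)).congr_of_eventuallyEq ?_
  filter_upwards [eventually_time_mem hz] with w hw using hΓ.signedDist_eq_inner hw

theorem fderiv_closestPointMap_snd (hπ : ContDiffAt ℝ ∞ (closestPointMap Γ) z) (h : E3) (k : ℝ) :
    (fderiv ℝ (closestPointMap Γ) z (h, k)).2 = k :=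
  congrArg (fun L => L (h, k))
    ((hπ.differentiableAt (by simp)).hasFDerivAt.snd.unique hasFDerivAt_snd)

theorem inner_normalExt_fderiv_closestPointMap (hΓ : IsMovingClosedSurface T Γ ν V)
    (hz : z.2 ∈ Ioo 0 T) (hπ : ContDiffAt ℝ ∞ (closestPointMap Γ) z) (h : E3) (k : ℝ) :
    inner ℝ (normalExt Γ ν z) (fderiv ℝ (closestPointMap Γ) z (h, k)).1 = normalExt Γ V z * k := by
  have hS := hΓ.closestPointMap_mem hz
  obtain ⟨U, φ, hU, hφ⟩ := hΓ.exists_localDefiningFunction hS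
  have hcomp : HasFDerivAt (φ ∘ closestPointMap Γ) _ z :=
    ((hφ.contDiffAt hU).differentiableAt (by simp)).hasFDerivAt.comp z
      (hπ.differentiableAt (by simp)).hasFDerivAt
  have hzero : φ ∘ closestPointMap Γ =ᶠ[𝓝 z] fun _ => 0 := by
    filter_upwards [hπ.continuousAt.eventually (hφ.isOpen.mem_nhds hU), eventually_time_mem hz]
      with w hwU hw using (hφ.mem_iff _ hwU).mp (hΓ.closestPointMap_mem hw)
  have hderiv : fderiv ℝ φ (closestPointMap Γ z) (fderiv ℝ (closestPointMap Γ) z (h, k)) = 0 :=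
    congrArg (fun L => L (h, k))
      (hcomp.unique ((hasFDerivAt_const 0 z).congr_of_eventuallyEq hzero))
  have hsplit : fderiv ℝ (closestPointMap Γ) z (h, k) =
      ((fderiv ℝ (closestPointMap Γ) z (h, k)).1, k) :=
    Prod.ext rfl (fderiv_closestPointMap_snd hπ h k)
  rw [hsplit, hφ.fderiv_apply hU hS, mul_eq_zero_iff_left
    (norm_ne_zero_iff.mpr (hφ.grad_ne_zero _ hU))] at hderiv
  exact sub_eq_zero.mp hderiv

theorem inner_normalExt_fderiv_normalExt (hΓ : IsMovingClosedSurface T Γ ν V)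
    (hz : z.2 ∈ Ioo 0 T) (hν : DifferentiableAt ℝ (normalExt Γ ν) z) (m : E3 × ℝ) :
    inner ℝ (normalExt Γ ν z) (fderiv ℝ (normalExt Γ ν) z m) = 0 := by
  have hconst : (fun w => ‖normalExt Γ ν w‖ ^ 2) =ᶠ[𝓝 z] fun _ => 1 := by
    filter_upwards [eventually_time_mem hz] with w hw
    have h : ‖normalExt Γ ν w‖ = 1 := hΓ.norm_normal (hΓ.closestPointMap_mem hw)
    rw [h, one_pow]
  have h := congrArg (fun L => L m)
    (hν.hasFDerivAt.norm_sq.unique ((hasFDerivAt_const 1 z).congr_of_eventuallyEq hconst))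
  simpa using h

theorem fderiv_signedDist_smul_normalExt_add (hΓ : IsMovingClosedSurface T Γ ν V)
    (hz : z.2 ∈ Ioo 0 T) (hπ : ContDiffAt ℝ ∞ (closestPointMap Γ) z) (h : E3) (k : ℝ) :
    fderiv ℝ (signedDist Γ ν) z (h, k) • normalExt Γ ν z +
      signedDist Γ ν z • fderiv ℝ (normalExt Γ ν) z (h, k) =
      h - (fderiv ℝ (closestPointMap Γ) z (h, k)).1 := by
  have hd := ((hΓ.contDiffAt_signedDist hz hπ).differentiableAt (by simp)).hasFDerivAt
  have hν := ((hΓ.contDiffAt_normalExt hz hπ hΓ.smoothOnSurface_normal).differentiableAt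
    (by simp)).hasFDerivAt
  have hsub := hasFDerivAt_fst.sub (hπ.differentiableAt (by simp)).hasFDerivAt.fst
  have heq : (fun w => signedDist Γ ν w • normalExt Γ ν w) =ᶠ[𝓝 z]
      fun w => w.1 - (closestPointMap Γ w).1 := by
    filter_upwards [eventually_time_mem hz] with w hw using hΓ.signedDist_smul_normal hw
  have h := congrArg (fun L => L (h, k)) ((hd.smul hν).unique (hsub.congr_of_eventuallyEq heq))
  simpa [add_comm] using h

theorem fderiv_signedDist (hΓ : IsMovingClosedSurface T Γ ν V) (hz : z.2 ∈ Ioo 0 T)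
    (hπ : ContDiffAt ℝ ∞ (closestPointMap Γ) z) (h : E3) (k : ℝ) :
    fderiv ℝ (signedDist Γ ν) z (h, k) =
      inner ℝ (normalExt Γ ν z) h - normalExt Γ V z * k := by
  have hν := (hΓ.contDiffAt_normalExt hz hπ hΓ.smoothOnSurface_normal).differentiableAt (by simp)
  have hunit : inner ℝ (normalExt Γ ν z) (normalExt Γ ν z) = (1 : ℝ) :=
    hΓ.inner_normal_self (hΓ.closestPointMap_mem hz)
  have hinner := congrArg (inner ℝ (normalExt Γ ν z))
    (hΓ.fderiv_signedDist_smul_normalExt_add hz hπ h k)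
  rwa [inner_add_right, real_inner_smul_right, real_inner_smul_right, inner_sub_right, hunit,
    hΓ.inner_normalExt_fderiv_normalExt hz hν, hΓ.inner_normalExt_fderiv_closestPointMap hz hπ,
    mul_one, mul_zero, add_zero] at hinner

theorem fderiv_closestPointMap_of_mem (hΓ : IsMovingClosedSurface T Γ ν V)
    (hz : z ∈ spaceTimeSurface T Γ) (h : E3) (k : ℝ) :
    fderiv ℝ (closestPointMap Γ) z (h, k) = (h - (inner ℝ (ν z) h - V z * k) • ν z, k) := by
  have hπ := (hΓ.eventually_contDiffAt_closestPointMap hz).self_of_nhds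
  have hsub := hΓ.fderiv_signedDist_smul_normalExt_add hz.1 hπ h k
  rw [hΓ.fderiv_signedDist hz.1 hπ, hΓ.signedDist_of_mem hz, zero_smul, add_zero,
    normalExt_of_mem ν hz, normalExt_of_mem V hz] at hsub
  exact Prod.ext (by rw [hsub, sub_sub_cancel]) (fderiv_closestPointMap_snd hπ h k)

/-! ### Surface operators through arbitrary extensions -/

theorem fderiv_normalExt {F : Type*} [NormedAddCommGroup F] [NormedSpace ℝ F] {f g : E3 × ℝ → F}
    (hΓ : IsMovingClosedSurface T Γ ν V) (hz : z ∈ spaceTimeSurface T Γ)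
    (hg : DifferentiableAt ℝ g z) (hgf : EqOn g f (spaceTimeSurface T Γ)) (h : E3) (k : ℝ) :
    fderiv ℝ (normalExt Γ f) z (h, k) =
      fderiv ℝ g z (h - (inner ℝ (ν z) h - V z * k) • ν z, k) := by
  have hπ := (hΓ.eventually_contDiffAt_closestPointMap hz).self_of_nhds
  have heq : normalExt Γ f =ᶠ[𝓝 z] g ∘ closestPointMap Γ := by
    filter_upwards [eventually_time_mem hz.1] with w hw using (hgf (hΓ.closestPointMap_mem hw)).symm
  rw [← closestPointMap_of_mem hz] at hg
  rw [heq.fderiv_eq, fderiv_comp z hg (hπ.differentiableAt (by simp)),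
    ContinuousLinearMap.comp_apply, hΓ.fderiv_closestPointMap_of_mem hz, closestPointMap_of_mem hz]

theorem tanD_eq {f g : E3 × ℝ → ℝ} (hΓ : IsMovingClosedSurface T Γ ν V)
    (hz : z ∈ spaceTimeSurface T Γ) (hg : DifferentiableAt ℝ g z)
    (hgf : EqOn g f (spaceTimeSurface T Γ)) (i : Fin 3) :
    tanD Γ ν i f z = dx i g z - ν z i * fderiv ℝ g z (ν z, 0) := by
  have hnormal : ∑ j, ν z j * dx j (normalExt Γ f) z = 0 := by
    have h := fderiv_apply_eq_sum (normalExt Γ f) z (ν z) 0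
    rw [hΓ.fderiv_normalExt hz hg hgf, hΓ.inner_normal_self hz] at h
    simpa [Prod.mk_zero_zero] using h.symm
  have htangential : dx i (normalExt Γ f) z = dx i g z - ν z i * fderiv ℝ g z (ν z, 0) := by
    have hsplit : (EuclideanSpace.single i 1 - ν z i • ν z, (0 : ℝ)) =
        ((EuclideanSpace.single i 1, 0) : E3 × ℝ) - ν z i • (ν z, 0) := by simp
    have hinner : inner ℝ (ν z) (EuclideanSpace.single i 1) = ν z i := by
      simp [EuclideanSpace.inner_single_right]
    rw [dx, hΓ.fderiv_normalExt hz hg hgf, hinner, mul_zero, sub_zero, hsplit, map_sub, map_smul,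
      smul_eq_mul, dx]
  have hproj : ∀ j, proj ν z i j * dx j (normalExt Γ f) z =
      (if i = j then dx j (normalExt Γ f) z else 0) -
        ν z i * (ν z j * dx j (normalExt Γ f) z) := fun j => by
    simp only [proj, Matrix.sub_apply, Matrix.one_apply, Matrix.vecMulVec_apply]
    split_ifs <;> ring
  rw [tanD, Finset.sum_congr rfl fun j _ => hproj j, Finset.sum_sub_distrib, ← Finset.mul_sum,
    hnormal, mul_zero, sub_zero, Finset.sum_ite_eq, if_pos (Finset.mem_univ i), htangential]

theorem materialDeriv_eq {v : E3 × ℝ → E3} {f g : E3 × ℝ → ℝ}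
    (hΓ : IsMovingClosedSurface T Γ ν V) (hz : z ∈ spaceTimeSurface T Γ)
    (hg : DifferentiableAt ℝ g z) (hgf : EqOn g f (spaceTimeSurface T Γ))
    (hv : inner ℝ (v z) (ν z) = V z) : materialDeriv Γ v f z = fderiv ℝ g z (v z, 1) := by
  have h := fderiv_apply_eq_sum (normalExt Γ f) z (v z) 1
  rw [hΓ.fderiv_normalExt hz hg hgf, real_inner_comm, hv] at h
  simpa [materialDeriv, add_comm] using h.symm

/-! ### The boundary of the thin domain -/

theorem hasOutwardNormal_thinDomain (hΓ : IsMovingClosedSurface T Γ ν V) {ε : ℝ}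
    (hz : z.2 ∈ Ioo 0 T) (hε : 0 < ε) (hd : signedDist Γ ν z = ε)
    (hπ : ∀ᶠ w in 𝓝 z, ContDiffAt ℝ ∞ (closestPointMap Γ) w) :
    HasOutwardNormal (thinDomain Γ ε) z (normalExt Γ ν z) (normalExt Γ V z) := by
  have hsmooth := hΓ.contDiffAt_signedDist hz hπ.self_of_nhds
  have hfderiv : fderiv ℝ (fun w => signedDist Γ ν w - ε) z = fderiv ℝ (signedDist Γ ν) z :=
    fderiv_sub_const ε
  have hgrad : grad (fun w => signedDist Γ ν w - ε) z = normalExt Γ ν z := by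
    ext i
    simp only [grad, dx, hfderiv, hΓ.fderiv_signedDist hz hπ.self_of_nhds]
    simp [EuclideanSpace.inner_single_right]
  have hdt : dt (fun w => signedDist Γ ν w - ε) z = -normalExt Γ V z := by
    simp [dt, hfderiv, hΓ.fderiv_signedDist hz hπ.self_of_nhds]
  have hunit : ‖normalExt Γ ν z‖ = 1 := hΓ.norm_normal (hΓ.closestPointMap_mem hz)
  refine ⟨fun w => signedDist Γ ν w - ε, hsmooth.sub contDiffAt_const, sub_eq_zero.mpr hd,
    ?_, ?_, ?_, ?_⟩
  · rw [hgrad, ← norm_ne_zero_iff, hunit]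
    exact one_ne_zero
  · have hpos : ∀ᶠ w in 𝓝 z, 0 < signedDist Γ ν w :=
      hsmooth.continuousAt.eventually (lt_mem_nhds (hd ▸ hε))
    filter_upwards [hpos, eventually_time_mem hz] with w hwpos hw
    rw [thinDomain, Metric.mem_thickening_iff_infDist_lt (hΓ.nonempty_slice hw),
      ← hΓ.abs_signedDist hw, abs_of_pos hwpos, sub_neg]
  · rw [hgrad, hunit, inv_one, one_smul]
  · rw [hgrad, hdt, hunit, neg_neg, div_one]

theorem mem_frontier_thinDomain (hΓ : IsMovingClosedSurface T Γ ν V) {ε : ℝ}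
    (hz : z.2 ∈ Ioo 0 T) (hε : 0 < ε) (hd : signedDist Γ ν z = ε) :
    z.1 ∈ frontier (thinDomain Γ ε z.2) := by
  have hinf : Metric.infDist z.1 (Γ z.2) = ε := by
    rw [← hΓ.abs_signedDist hz, hd, abs_of_pos hε]
  rw [thinDomain, frontier, Metric.isOpen_thickening.interior_eq, closure_thickening hε]
  constructor
  · exact Metric.mem_cthickening_of_dist_le _ _ _ _ (hΓ.closestPointMap_mem hz).2
      ((hΓ.dist_closestPointMap hz).trans hinf).le
  · rw [Metric.mem_thickening_iff_infDist_lt (hΓ.nonempty_slice hz), hinf]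
    exact lt_irrefl ε

theorem eventually_hasOutwardNormal_normalLine (hΓ : IsMovingClosedSurface T Γ ν V)
    (hz₀ : z₀ ∈ spaceTimeSurface T Γ) :
    ∀ᶠ ε in 𝓝[>] (0 : ℝ), (normalLine ν z₀ ε).1 ∈ frontier (thinDomain Γ ε z₀.2) ∧
      HasOutwardNormal (thinDomain Γ ε) (normalLine ν z₀ ε) (ν z₀) (V z₀) := by
  have hsmooth := (tendsto_normalLine ν z₀).eventually
    (hΓ.eventually_contDiffAt_closestPointMap hz₀).eventually_nhds
  filter_upwards [self_mem_nhdsWithin, mem_nhdsWithin_of_mem_nhds hsmooth,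
    mem_nhdsWithin_of_mem_nhds (hΓ.eventually_closestPointMap_normalLine hz₀)] with ε hε hπ hline
  have hd := hΓ.signedDist_normalLine hz₀ hline
  have hnormal : normalExt Γ ν (normalLine ν z₀ ε) = ν z₀ := congrArg ν hline
  have hvelocity : normalExt Γ V (normalLine ν z₀ ε) = V z₀ := congrArg V hline
  have ht : (normalLine ν z₀ ε).2 ∈ Ioo 0 T := hz₀.1
  refine ⟨hΓ.mem_frontier_thinDomain ht hε hd, ?_⟩
  rw [← hnormal, ← hvelocity]
  exact hΓ.hasOutwardNormal_thinDomain ht hε hd hπ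

end IsMovingClosedSurface

/-! ### Vanishing Taylor coefficients -/

theorem tendsto_pow_nhdsGT_zero {n : ℕ} (hn : n ≠ 0) :
    Tendsto (fun ε : ℝ => ε ^ n) (𝓝[>] 0) (𝓝 0) :=
  Tendsto.mono_left (by simpa [hn] using (continuous_pow n).tendsto (0 : ℝ)) nhdsWithin_le_nhds

theorem eq_zero_of_isBigO_sq {F : Type*} [NormedAddCommGroup F] [NormedSpace ℝ F] {g : ℝ → F}
    {g' : F} (hg : HasDerivAt g g' 0) (hO : g =O[𝓝[>] 0] fun ε : ℝ => ε ^ 2) :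
    g 0 = 0 ∧ g' = 0 := by
  have hg₀ : g 0 = 0 :=
    tendsto_nhds_unique (hg.continuousAt.tendsto.mono_left nhdsWithin_le_nhds)
      (hO.trans_tendsto (tendsto_pow_nhdsGT_zero two_ne_zero))
  have hslope : Tendsto (fun ε : ℝ => ε⁻¹ • g ε) (𝓝[>] 0) (𝓝 g') := by
    simpa [hg₀] using hg.tendsto_slope_zero_right
  have hslopeO : (fun ε : ℝ => ε⁻¹ • g ε) =O[𝓝[>] 0] fun ε : ℝ => ε ^ 1 := by
    refine ((Asymptotics.isBigO_refl _ _).smul hO).congr' .rfl ?_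
    filter_upwards [self_mem_nhdsWithin] with ε (hε : 0 < ε)
    rw [smul_eq_mul]
    field_simp
  exact ⟨hg₀, tendsto_nhds_unique hslope
    (hslopeO.trans_tendsto (tendsto_pow_nhdsGT_zero one_ne_zero))⟩

theorem eq_zero_of_isBigO_cube {g g₁ : ℝ → ℝ} {g₂ : ℝ}
    (hg : ∀ᶠ r in 𝓝 0, HasDerivAt g (g₁ r) r) (hg₁ : HasDerivAt g₁ g₂ 0)
    (hO : g =O[𝓝[>] 0] fun ε => ε ^ 3) : g 0 = 0 ∧ g₁ 0 = 0 ∧ g₂ = 0 := by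
  have hsmall : (fun ε : ℝ => ε ^ 3) =O[𝓝[>] 0] fun ε => ε ^ 2 :=
    ((Asymptotics.isLittleO_pow_pow (by norm_num)).mono nhdsWithin_le_nhds).isBigO
  obtain ⟨hg₀, hg₁₀⟩ := eq_zero_of_isBigO_sq hg.self_of_nhds (hO.trans hsmall)
  have hslope : Tendsto (fun r => g₁ r / (2 * r)) (𝓝[>] 0) (𝓝 (g₂ / 2)) := by
    have h : Tendsto (fun r => r⁻¹ * g₁ r / 2) (𝓝[>] 0) (𝓝 (g₂ / 2)) := by
      simpa [hg₁₀] using hg₁.tendsto_slope_zero_right.div_const 2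
    exact h.congr fun r => by ring
  have htaylor : Tendsto (fun r => g r / r ^ 2) (𝓝[>] 0) (𝓝 (g₂ / 2)) := by
    refine HasDerivAt.lhopital_zero_nhdsGT (hg.filter_mono nhdsWithin_le_nhds)
      (g' := fun r => 2 * r) (.of_forall fun r => by simpa using hasDerivAt_pow 2 r) ?_ ?_
      (tendsto_pow_nhdsGT_zero two_ne_zero) hslope
    · filter_upwards [self_mem_nhdsWithin] with r (hr : 0 < r) using by positivity
    · simpa only [hg₀] using
        hg.self_of_nhds.continuousAt.tendsto.mono_left nhdsWithin_le_nhds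
  have hquot : (fun r => g r / r ^ 2) =O[𝓝[>] 0] fun r : ℝ => r ^ 1 := by
    refine (hO.mul (Asymptotics.isBigO_refl (fun r : ℝ => (r ^ 2)⁻¹) _)).congr' .rfl ?_
    filter_upwards [self_mem_nhdsWithin] with r (hr : 0 < r)
    field_simp
  have hg₂ := tendsto_nhds_unique htaylor
    (hquot.trans_tendsto (tendsto_pow_nhdsGT_zero one_ne_zero))
  exact ⟨hg₀, hg₁₀, by linarith⟩

/-! ### Components of derivatives -/

theorem fderiv_component {E : Type*} [NormedAddCommGroup E] [NormedSpace ℝ E] {f : E → E3} {a : E}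
    (hf : DifferentiableAt ℝ f a) (j : Fin 3) (m : E) :
    fderiv ℝ (fun w => f w j) a m = fderiv ℝ f a m j :=
  congrArg (· m)
    ((EuclideanSpace.proj (𝕜 := ℝ) j).hasFDerivAt.comp a hf.hasFDerivAt).fderiv

theorem dx_dx_eq_fderiv_fderiv {F : Type*} [NormedAddCommGroup F] [NormedSpace ℝ F]
    {f : E3 × ℝ → F} (hf : ContDiffAt ℝ 2 f z) (i k : Fin 3) :
    dx i (dx k f) z =
      fderiv ℝ (fderiv ℝ f) z (EuclideanSpace.single i 1, 0) (EuclideanSpace.single k 1, 0) := by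
  have hd : DifferentiableAt ℝ (fderiv ℝ f) z :=
    (hf.fderiv_right (m := 1) (by norm_num)).differentiableAt one_ne_zero
  change fderiv ℝ (fun w => fderiv ℝ f w (EuclideanSpace.single k 1, 0)) z _ = _
  rw [fderiv_clm_apply hd (differentiableAt_const _)]
  simp

theorem contDiffAt_dx {F : Type*} [NormedAddCommGroup F] [NormedSpace ℝ F] {f : E3 × ℝ → F}
    (hf : ContDiffAt ℝ 2 f z) (i : Fin 3) : ContDiffAt ℝ 1 (dx i f) z :=
  (hf.fderiv_right (m := 1) (by norm_num)).clm_apply contDiffAt_const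

theorem dx_dx_comm {F : Type*} [NormedAddCommGroup F] [NormedSpace ℝ F] {f : E3 × ℝ → F}
    (hf : ContDiffAt ℝ 2 f z) (i k : Fin 3) : dx i (dx k f) z = dx k (dx i f) z := by
  rw [dx_dx_eq_fderiv_fderiv hf, dx_dx_eq_fderiv_fderiv hf]
  exact hf.isSymmSndFDerivAt (by simp) _ _

theorem dx_dx_component {f : E3 × ℝ → E3} (hf : ContDiffAt ℝ 2 f z) (i k j : Fin 3) :
    dx i (dx k fun w => f w j) z = dx i (dx k f) z j := by
  have heq : (dx k fun w => f w j) =ᶠ[𝓝 z] fun w => dx k f w j := by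
    filter_upwards [hf.eventually (by simp)] with w hw
      using fderiv_component (hw.differentiableAt two_ne_zero) j _
  rw [dx, heq.fderiv_eq, fderiv_component ((contDiffAt_dx hf k).differentiableAt one_ne_zero), dx]

theorem dx_eq_zero_of_eventually {F : Type*} [NormedAddCommGroup F] [NormedSpace ℝ F]
    {f : E3 × ℝ → F} (hf : DifferentiableAt ℝ f z) (h₀ : ∀ᶠ x in 𝓝 z.1, f (x, z.2) = 0)
    (i : Fin 3) : dx i f z = 0 := by
  have hslice : HasFDerivAt (fun x => f (x, z.2))
      ((fderiv ℝ f z).comp (ContinuousLinearMap.inl ℝ E3 ℝ)) z.1 :=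
    hf.hasFDerivAt.comp z.1 (hasFDerivAt_prodMk_left z.1 z.2)
  have hzero : HasFDerivAt (fun x => f (x, z.2)) (0 : E3 →L[ℝ] F) z.1 :=
    (hasFDerivAt_const 0 z.1).congr_of_eventuallyEq h₀
  exact DFunLike.congr_fun (hslice.unique hzero) (EuclideanSpace.single i 1)

/-! ### Remainders -/

theorem eventually_mem_thinDomain (hz : z ∈ spaceTimeSurface T Γ) :
    ∀ᶠ ε in 𝓝[>] (0 : ℝ), z.1 ∈ thinDomain Γ ε z.2 := by
  filter_upwards [self_mem_nhdsWithin] with ε hε using Metric.self_subset_thickening hε _ hz.2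

theorem eventually_mem_closure_thinDomain (hz : z ∈ spaceTimeSurface T Γ) :
    ∀ᶠ ε in 𝓝[>] (0 : ℝ), z.1 ∈ closure (thinDomain Γ ε z.2) :=
  (eventually_mem_thinDomain hz).mono fun _ h => subset_closure h

namespace IsRemainder

variable {F : Type*} [NormedAddCommGroup F] [NormedSpace ℝ F] {k l : ℕ} {f : ℝ → E3 × ℝ → F}
  {W : E3 × ℝ → F}

theorem isBigO_iteratedFDeriv_sub {t : ℝ} {x : ℝ → E3}
    (hR : IsRemainder T Γ k fun ε z => f ε z - W z) (hl : l < k) (ht : t ∈ Ioo 0 T)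
    (hx : ∀ᶠ ε in 𝓝[>] (0 : ℝ), x ε ∈ closure (thinDomain Γ ε t))
    (hf : ∀ᶠ ε in 𝓝[>] (0 : ℝ), ContDiffAt ℝ l (f ε) (x ε, t))
    (hW : ∀ᶠ ε in 𝓝[>] (0 : ℝ), ContDiffAt ℝ l W (x ε, t)) :
    (fun ε => iteratedFDeriv ℝ l (f ε) (x ε, t) - iteratedFDeriv ℝ l W (x ε, t))
      =O[𝓝[>] 0] fun ε => ε ^ (k - l) := by
  obtain ⟨C, hC⟩ := hR t ht
  refine .of_bound C ?_
  filter_upwards [hC, hx, hf, hW, self_mem_nhdsWithin] with ε hCε hxε hfε hWε (hε : 0 < ε)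
  rw [← fun_iteratedFDeriv_sub_apply hfε hWε, Real.norm_of_nonneg (by positivity)]
  exact hCε _ hxε l hl

theorem isBigO_sub {t : ℝ} {x : ℝ → E3} (hR : IsRemainder T Γ k fun ε z => f ε z - W z)
    (hk : 0 < k) (ht : t ∈ Ioo 0 T)
    (hx : ∀ᶠ ε in 𝓝[>] (0 : ℝ), x ε ∈ closure (thinDomain Γ ε t)) :
    (fun ε => f ε (x ε, t) - W (x ε, t)) =O[𝓝[>] 0] fun ε => ε ^ k := by
  obtain ⟨C, hC⟩ := hR t ht
  refine .of_bound C ?_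
  filter_upwards [hC, hx, self_mem_nhdsWithin] with ε hCε hxε (hε : 0 < ε)
  rw [Real.norm_of_nonneg (by positivity)]
  simpa using hCε _ hxε 0 hk

theorem isBigO_fderiv_sub {t : ℝ} {x : ℝ → E3} (hR : IsRemainder T Γ k fun ε z => f ε z - W z)
    (hk : 1 < k) (ht : t ∈ Ioo 0 T)
    (hx : ∀ᶠ ε in 𝓝[>] (0 : ℝ), x ε ∈ closure (thinDomain Γ ε t))
    (hf : ∀ᶠ ε in 𝓝[>] (0 : ℝ), ContDiffAt ℝ 1 (f ε) (x ε, t))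
    (hW : ∀ᶠ ε in 𝓝[>] (0 : ℝ), ContDiffAt ℝ 1 W (x ε, t)) (m : E3 × ℝ) :
    (fun ε => fderiv ℝ (f ε) (x ε, t) m - fderiv ℝ W (x ε, t) m)
      =O[𝓝[>] 0] fun ε => ε ^ (k - 1) := by
  simpa [iteratedFDeriv_one_apply] using
    ((ContinuousMultilinearMap.apply ℝ (fun _ : Fin 1 => E3 × ℝ) F ![m]).isBigO_comp _ _).trans
      (hR.isBigO_iteratedFDeriv_sub hk ht hx hf hW)

theorem tendsto_iteratedFDeriv (hR : IsRemainder T Γ k fun ε z => f ε z - W z) (hl : l < k)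
    (hz : z ∈ spaceTimeSurface T Γ) (hf : ∀ᶠ ε in 𝓝[>] (0 : ℝ), ContDiffAt ℝ l (f ε) z)
    (hW : ContDiffAt ℝ l W z) :
    Tendsto (fun ε => iteratedFDeriv ℝ l (f ε) z) (𝓝[>] 0) (𝓝 (iteratedFDeriv ℝ l W z)) := by
  have hO := hR.isBigO_iteratedFDeriv_sub hl hz.1 (eventually_mem_closure_thinDomain hz) hf
    (.of_forall fun _ => hW)
  exact tendsto_sub_nhds_zero_iff.mp
    (hO.trans_tendsto (tendsto_pow_nhdsGT_zero (Nat.sub_ne_zero_of_lt hl)))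

theorem tendsto_apply (hR : IsRemainder T Γ k fun ε z => f ε z - W z) (hk : 0 < k)
    (hz : z ∈ spaceTimeSurface T Γ) : Tendsto (fun ε => f ε z) (𝓝[>] 0) (𝓝 (W z)) :=
  tendsto_sub_nhds_zero_iff.mp
    ((hR.isBigO_sub hk hz.1 (eventually_mem_closure_thinDomain hz)).trans_tendsto
      (tendsto_pow_nhdsGT_zero hk.ne'))

theorem tendsto_fderiv (hR : IsRemainder T Γ k fun ε z => f ε z - W z) (hk : 1 < k)
    (hz : z ∈ spaceTimeSurface T Γ) (hf : ∀ᶠ ε in 𝓝[>] (0 : ℝ), ContDiffAt ℝ 1 (f ε) z)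
    (hW : ContDiffAt ℝ 1 W z) (m : E3 × ℝ) :
    Tendsto (fun ε => fderiv ℝ (f ε) z m) (𝓝[>] 0) (𝓝 (fderiv ℝ W z m)) := by
  simpa [iteratedFDeriv_one_apply, Function.comp_def] using
    ((ContinuousMultilinearMap.apply ℝ (fun _ : Fin 1 => E3 × ℝ) F ![m]).continuous.tendsto
      _).comp (hR.tendsto_iteratedFDeriv hk hz hf hW)

theorem tendsto_dx_dx (hR : IsRemainder T Γ k fun ε z => f ε z - W z) (hk : 2 < k)
    (hz : z ∈ spaceTimeSurface T Γ) (hf : ∀ᶠ ε in 𝓝[>] (0 : ℝ), ContDiffAt ℝ 2 (f ε) z)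
    (hW : ContDiffAt ℝ 2 W z) (i j : Fin 3) :
    Tendsto (fun ε => dx i (dx j (f ε)) z) (𝓝[>] 0) (𝓝 (dx i (dx j W) z)) := by
  rw [dx_dx_eq_fderiv_fderiv hW]
  have hlim : Tendsto (fun ε => fderiv ℝ (fderiv ℝ (f ε)) z (EuclideanSpace.single i 1, 0)
      (EuclideanSpace.single j 1, 0)) (𝓝[>] 0) (𝓝 (fderiv ℝ (fderiv ℝ W) z
        (EuclideanSpace.single i 1, 0) (EuclideanSpace.single j 1, 0))) := by
    simpa [iteratedFDeriv_two_apply, Function.comp_def] using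
      ((ContinuousMultilinearMap.apply ℝ (fun _ : Fin 2 => E3 × ℝ) F
        ![(EuclideanSpace.single i 1, 0), (EuclideanSpace.single j 1, 0)]).continuous.tendsto
        _).comp (hR.tendsto_iteratedFDeriv hk hz hf hW)
  exact hlim.congr' (hf.mono fun ε hε => (dx_dx_eq_fderiv_fderiv hε i j).symm)

end IsRemainder

/-! ### Strain rates -/

theorem strain_apply (f : E3 × ℝ → E3) (z : E3 × ℝ) (a b : Fin 3) :
    strain f z a b = (1 / 2 : ℝ) * (dx a (fun w => f w b) z + dx b (fun w => f w a) z) := by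
  simp [strain, gradMat]

theorem transpose_strain (f : E3 × ℝ → E3) (z : E3 × ℝ) : (strain f z)ᵀ = strain f z := by
  rw [strain, Matrix.transpose_smul, Matrix.transpose_add, Matrix.transpose_transpose, add_comm]

theorem contDiffAt_strain_apply {f : E3 × ℝ → E3} (hf : ContDiffAt ℝ 2 f z) (a b : Fin 3) :
    ContDiffAt ℝ 1 (fun w => strain f w a b) z := by
  simp only [strain_apply]
  exact contDiffAt_const.mul ((contDiffAt_dx (contDiffAt_euclidean.mp hf b) a).add
    (contDiffAt_dx (contDiffAt_euclidean.mp hf a) b))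

theorem dx_strain_apply {f : E3 × ℝ → E3} (hf : ContDiffAt ℝ 2 f z) (i a b : Fin 3) :
    dx i (fun w => strain f w a b) z =
      (1 / 2 : ℝ) * (dx i (dx a fun w => f w b) z + dx i (dx b fun w => f w a) z) := by
  have hd : ∀ a b, DifferentiableAt ℝ (dx a fun w => f w b) z := fun a b =>
    (contDiffAt_dx (contDiffAt_euclidean.mp hf b) a).differentiableAt one_ne_zero
  simp only [strain_apply]
  rw [dx, fderiv_const_mul ((hd a b).fun_add (hd b a)), fderiv_fun_add (hd a b) (hd b a)]
  simp [dx, mul_add]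

theorem dotProduct_strain_mulVec {f : E3 × ℝ → E3} (hf : DifferentiableAt ℝ f z) (n : E3) :
    n.ofLp ⬝ᵥ strain f z *ᵥ n.ofLp = inner ℝ (fderiv ℝ f z (n, 0)) n := by
  have hcomp : ∀ b, fderiv ℝ f z (n, 0) b = ∑ a, n a * dx a (fun w => f w b) z := fun b => by
    simpa [fderiv_component hf] using fderiv_apply_eq_sum (fun w => f w b) z n 0
  simp only [PiLp.inner_apply, hcomp, Matrix.mulVec, dotProduct, strain_apply, Fin.sum_univ_three]
  simp
  ring

theorem hasDerivAt_strain_normalLine {f : E3 × ℝ → E3} (hf : ContDiffAt ℝ 2 f z) (n : E3) :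
    HasDerivAt (fun r => strain f (normalLine ν z r) *ᵥ n.ofLp)
      (fderiv ℝ (fun w => strain f w *ᵥ n.ofLp) z (ν z, 0)) 0 := by
  have hd : DifferentiableAt ℝ (fun w => strain f w *ᵥ n.ofLp) z := by
    refine differentiableAt_pi.mpr fun a => ?_
    simp only [Matrix.mulVec, dotProduct]
    exact .fun_sum fun b _ =>
      ((contDiffAt_strain_apply hf a b).differentiableAt one_ne_zero).mul_const _
  exact hd.hasFDerivAt.comp_hasDerivAt_of_eq 0 (hasDerivAt_normalLine ν z 0)
    (normalLine_zero ν z).symm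

theorem hasDerivAt_inner_normalLine {f : E3 × ℝ → E3} {r : ℝ}
    (hf : DifferentiableAt ℝ f (normalLine ν z r)) (c : ℝ) :
    HasDerivAt (fun r => inner ℝ (f (normalLine ν z r)) (ν z) - c)
      ((ν z).ofLp ⬝ᵥ strain f (normalLine ν z r) *ᵥ (ν z).ofLp) r := by
  rw [dotProduct_strain_mulVec hf]
  have hderiv := (hf.hasFDerivAt.comp_hasDerivAt r (hasDerivAt_normalLine ν z r)).inner ℝ
    (hasDerivAt_const r (ν z))
  simpa using hderiv.sub_const c

theorem transpose_proj (ν : E3 × ℝ → E3) (z : E3 × ℝ) : (proj ν z)ᵀ = proj ν z := by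
  simp [proj, Matrix.transpose_vecMulVec]

theorem proj_mulVec (ν : E3 × ℝ → E3) (z : E3 × ℝ) (a : Fin 3 → ℝ) :
    proj ν z *ᵥ a = a - ((ν z).ofLp ⬝ᵥ a) • (ν z).ofLp := by
  rw [proj, Matrix.sub_mulVec, Matrix.one_mulVec, Matrix.vecMulVec_mulVec, op_smul_eq_smul]

theorem eq_zero_of_proj_mulVec_eq_zero {a : Fin 3 → ℝ} (hn : (ν z).ofLp ⬝ᵥ a = 0)
    (hp : proj ν z *ᵥ a = 0) : a = 0 := by
  rwa [proj_mulVec, hn, zero_smul, sub_zero] at hp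

/-! ### The thin limit of the boundary conditions -/

section ThinLimit

variable {μ₀ : ℝ} {u : ℝ → E3 × ℝ → E3} {p : ℝ → E3 × ℝ → ℝ} {W : E3 × ℝ → E3} {Q : E3 × ℝ → ℝ}

theorem eventually_normalLine_mem_closure (hΓ : IsMovingClosedSurface T Γ ν V)
    (hz : z ∈ spaceTimeSurface T Γ) :
    ∀ᶠ ε in 𝓝[>] (0 : ℝ), (normalLine ν z ε).1 ∈ closure (thinDomain Γ ε z.2) :=
  (hΓ.eventually_hasOutwardNormal_normalLine hz).mono fun _ h => frontier_subset_closure h.1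

theorem isBigO_inner_normalLine (hΓ : IsMovingClosedSurface T Γ ν V)
    (hNS : ∀ᶠ ε in 𝓝[>] (0 : ℝ), IsNavierStokesSolution μ₀ T (thinDomain Γ ε) (u ε) (p ε))
    {k : ℕ} (hk : 0 < k) (hu : IsRemainder T Γ k fun ε z => u ε z - W z)
    (hz : z ∈ spaceTimeSurface T Γ) :
    (fun ε => inner ℝ (W (normalLine ν z ε)) (ν z) - V z) =O[𝓝[>] 0] fun ε => ε ^ k := by
  have hO : (fun ε => -inner ℝ (ν z) (u ε (normalLine ν z ε) - W (normalLine ν z ε)))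
      =O[𝓝[>] 0] fun ε => ε ^ k :=
    (((innerSL ℝ (ν z)).isBigO_comp _ _).trans
      (hu.isBigO_sub hk hz.1 (eventually_normalLine_mem_closure hΓ hz))).neg_left
  refine hO.congr' ?_ .rfl
  filter_upwards [hNS, hΓ.eventually_hasOutwardNormal_normalLine hz] with ε hS hn
  rw [← hS.boundary_normal _ hz.1 _ hn.1 _ _ hn.2, inner_sub_right, neg_sub, real_inner_comm,
    real_inner_comm (u ε _)]
  rfl

theorem isBigO_strain_sub (hΓ : IsMovingClosedSurface T Γ ν V)
    (hNS : ∀ᶠ ε in 𝓝[>] (0 : ℝ), IsNavierStokesSolution μ₀ T (thinDomain Γ ε) (u ε) (p ε))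
    (hW : ContDiffAt ℝ 2 W z) {k : ℕ} (hk : 1 < k) (hu : IsRemainder T Γ k fun ε z => u ε z - W z)
    (hz : z ∈ spaceTimeSurface T Γ) (n : Fin 3 → ℝ) :
    (fun ε => (strain (u ε) (normalLine ν z ε) - strain W (normalLine ν z ε)) *ᵥ n)
      =O[𝓝[>] 0] fun ε => ε ^ (k - 1) := by
  have hcl := eventually_normalLine_mem_closure hΓ hz
  have huC : ∀ᶠ ε in 𝓝[>] (0 : ℝ), ContDiffAt ℝ 1 (u ε) (normalLine ν z ε) := by
    filter_upwards [hNS, hcl] with ε hS hε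
      using (hS.contDiffAt_velocity _ hz.1 _ hε).of_le one_le_two
  have hWC : ∀ᶠ ε in 𝓝[>] (0 : ℝ), ContDiffAt ℝ 1 W (normalLine ν z ε) :=
    ((tendsto_normalLine ν z).mono_left nhdsWithin_le_nhds).eventually
      ((hW.of_le one_le_two).eventually (by simp))
  have hdx : ∀ a b, (fun ε => dx a (fun w => u ε w b) (normalLine ν z ε) -
      dx a (fun w => W w b) (normalLine ν z ε)) =O[𝓝[>] 0] fun ε => ε ^ (k - 1) := by
    intro a b
    refine (((EuclideanSpace.proj (𝕜 := ℝ) b : E3 →L[ℝ] ℝ).isBigO_comp _ _).trans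
      (hu.isBigO_fderiv_sub hk hz.1 hcl huC hWC (EuclideanSpace.single a 1, 0))).congr' ?_ .rfl
    filter_upwards [huC, hWC] with ε h₁ h₂
    rw [dx, dx, fderiv_component (h₁.differentiableAt one_ne_zero),
      fderiv_component (h₂.differentiableAt one_ne_zero)]
    rfl
  refine Asymptotics.isBigO_pi.mpr fun a => ?_
  simp only [Matrix.mulVec, dotProduct]
  refine .fun_sum fun b _ =>
    (((hdx a b).add (hdx b a)).const_mul_left (n b / 2)).congr_left fun ε => ?_
  simp only [Matrix.sub_apply, strain_apply]
  ring

theorem isBigO_proj_strain_normalLine (hΓ : IsMovingClosedSurface T Γ ν V)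
    (hNS : ∀ᶠ ε in 𝓝[>] (0 : ℝ), IsNavierStokesSolution μ₀ T (thinDomain Γ ε) (u ε) (p ε))
    (hW : ContDiffAt ℝ 2 W z) {k : ℕ} (hk : 1 < k) (hu : IsRemainder T Γ k fun ε z => u ε z - W z)
    (hz : z ∈ spaceTimeSurface T Γ) :
    (fun ε => proj ν z *ᵥ strain W (normalLine ν z ε) *ᵥ (ν z).ofLp)
      =O[𝓝[>] 0] fun ε => ε ^ (k - 1) := by
  have hO := (((proj ν z).mulVecLin.toContinuousLinearMap.isBigO_comp _ _).trans
    (isBigO_strain_sub hΓ hNS hW hk hu hz (ν z).ofLp)).neg_left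
  refine hO.congr' ?_ .rfl
  filter_upwards [hNS, hΓ.eventually_hasOutwardNormal_normalLine hz] with ε hS hn
  have hslip : proj ν z *ᵥ strain (u ε) (normalLine ν z ε) *ᵥ (ν z).ofLp = 0 :=
    hS.boundary_tangential _ hz.1 _ hn.1 _ _ hn.2
  simp [Matrix.sub_mulVec, Matrix.mulVec_sub, hslip]

theorem inner_normal_eq_and_normal_strain_eq_zero (hΓ : IsMovingClosedSurface T Γ ν V)
    (hNS : ∀ᶠ ε in 𝓝[>] (0 : ℝ), IsNavierStokesSolution μ₀ T (thinDomain Γ ε) (u ε) (p ε))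
    (hW : ContDiffAt ℝ 2 W z) (hu : IsRemainder T Γ 3 fun ε z => u ε z - W z)
    (hz : z ∈ spaceTimeSurface T Γ) :
    inner ℝ (W z) (ν z) = V z ∧ (ν z).ofLp ⬝ᵥ strain W z *ᵥ (ν z).ofLp = 0 ∧
      (ν z).ofLp ⬝ᵥ fderiv ℝ (fun w => strain W w *ᵥ (ν z).ofLp) z (ν z, 0) = 0 := by
  have hderiv : ∀ᶠ r in 𝓝 (0 : ℝ),
      HasDerivAt (fun r => inner ℝ (W (normalLine ν z r)) (ν z) - V z)
        ((ν z).ofLp ⬝ᵥ strain W (normalLine ν z r) *ᵥ (ν z).ofLp) r := by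
    filter_upwards [(tendsto_normalLine ν z).eventually (hW.eventually (by simp))] with r hr
      using hasDerivAt_inner_normalLine (hr.differentiableAt two_ne_zero) _
  have hderiv₂ := (dotProductBilin ℝ ℝ (ν z).ofLp).toContinuousLinearMap.hasFDerivAt
    |>.comp_hasDerivAt 0 (hasDerivAt_strain_normalLine (ν := ν) hW (ν z))
  simpa [normalLine_zero, sub_eq_zero] using
    eq_zero_of_isBigO_cube hderiv hderiv₂ (isBigO_inner_normalLine hΓ hNS three_pos hu hz)

theorem tangential_strain_eq_zero (hΓ : IsMovingClosedSurface T Γ ν V)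
    (hNS : ∀ᶠ ε in 𝓝[>] (0 : ℝ), IsNavierStokesSolution μ₀ T (thinDomain Γ ε) (u ε) (p ε))
    (hW : ContDiffAt ℝ 2 W z) (hu : IsRemainder T Γ 3 fun ε z => u ε z - W z)
    (hz : z ∈ spaceTimeSurface T Γ) :
    proj ν z *ᵥ strain W z *ᵥ (ν z).ofLp = 0 ∧
      proj ν z *ᵥ fderiv ℝ (fun w => strain W w *ᵥ (ν z).ofLp) z (ν z, 0) = 0 := by
  have hderiv := ((proj ν z).mulVecLin.toContinuousLinearMap).hasFDerivAt.comp_hasDerivAt 0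
    (hasDerivAt_strain_normalLine (ν := ν) hW (ν z))
  simpa [normalLine_zero] using
    eq_zero_of_isBigO_sq hderiv (isBigO_proj_strain_normalLine hΓ hNS hW (by norm_num) hu hz)

theorem strain_mulVec_normal_eq_zero (hΓ : IsMovingClosedSurface T Γ ν V)
    (hNS : ∀ᶠ ε in 𝓝[>] (0 : ℝ), IsNavierStokesSolution μ₀ T (thinDomain Γ ε) (u ε) (p ε))
    (hW : ContDiffAt ℝ 2 W z) (hu : IsRemainder T Γ 3 fun ε z => u ε z - W z)
    (hz : z ∈ spaceTimeSurface T Γ) :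
    strain W z *ᵥ (ν z).ofLp = 0 ∧
      fderiv ℝ (fun w => strain W w *ᵥ (ν z).ofLp) z (ν z, 0) = 0 := by
  obtain ⟨-, hn, hn'⟩ := inner_normal_eq_and_normal_strain_eq_zero hΓ hNS hW hu hz
  obtain ⟨hp, hp'⟩ := tangential_strain_eq_zero hΓ hNS hW hu hz
  exact ⟨eq_zero_of_proj_mulVec_eq_zero hn hp, eq_zero_of_proj_mulVec_eq_zero hn' hp'⟩

/-! ### The thin limit of the bulk equations -/

theorem eventually_contDiffAt_velocity
    (hNS : ∀ᶠ ε in 𝓝[>] (0 : ℝ), IsNavierStokesSolution μ₀ T (thinDomain Γ ε) (u ε) (p ε))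
    (hz : z ∈ spaceTimeSurface T Γ) : ∀ᶠ ε in 𝓝[>] (0 : ℝ), ContDiffAt ℝ 2 (u ε) z := by
  filter_upwards [hNS, eventually_mem_closure_thinDomain hz] with ε hS hε
    using hS.contDiffAt_velocity _ hz.1 _ hε

theorem tendsto_fderiv_velocity
    (hNS : ∀ᶠ ε in 𝓝[>] (0 : ℝ), IsNavierStokesSolution μ₀ T (thinDomain Γ ε) (u ε) (p ε))
    (hW : ContDiffAt ℝ 2 W z) {k : ℕ} (hk : 1 < k) (hu : IsRemainder T Γ k fun ε z => u ε z - W z)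
    (hz : z ∈ spaceTimeSurface T Γ) (j : Fin 3) (m : E3 × ℝ) :
    Tendsto (fun ε => fderiv ℝ (fun w => u ε w j) z m) (𝓝[>] 0)
      (𝓝 (fderiv ℝ (fun w => W w j) z m)) := by
  have huC := eventually_contDiffAt_velocity hNS hz
  rw [fderiv_component (hW.differentiableAt two_ne_zero)]
  refine (((EuclideanSpace.proj (𝕜 := ℝ) j).continuous.tendsto _).comp (hu.tendsto_fderiv hk hz
    (huC.mono fun _ h => h.of_le one_le_two) (hW.of_le one_le_two) m)).congr' ?_
  exact huC.mono fun ε h => (fderiv_component (h.differentiableAt two_ne_zero) j m).symm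

theorem tendsto_dx_dx_velocity
    (hNS : ∀ᶠ ε in 𝓝[>] (0 : ℝ), IsNavierStokesSolution μ₀ T (thinDomain Γ ε) (u ε) (p ε))
    (hW : ContDiffAt ℝ 2 W z) {k : ℕ} (hk : 2 < k) (hu : IsRemainder T Γ k fun ε z => u ε z - W z)
    (hz : z ∈ spaceTimeSurface T Γ) (j i l : Fin 3) :
    Tendsto (fun ε => dx i (dx l fun w => u ε w j) z) (𝓝[>] 0)
      (𝓝 (dx i (dx l fun w => W w j) z)) := by
  have huC := eventually_contDiffAt_velocity hNS hz
  rw [dx_dx_component hW]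
  refine (((EuclideanSpace.proj (𝕜 := ℝ) j).continuous.tendsto _).comp
    (hu.tendsto_dx_dx hk hz huC hW i l)).congr' ?_
  exact huC.mono fun ε h => (dx_dx_component h i l j).symm

theorem divergence_eq_zero
    (hNS : ∀ᶠ ε in 𝓝[>] (0 : ℝ), IsNavierStokesSolution μ₀ T (thinDomain Γ ε) (u ε) (p ε))
    (hW : ContDiffAt ℝ 2 W z) {k : ℕ} (hk : 1 < k) (hu : IsRemainder T Γ k fun ε z => u ε z - W z)
    (hz : z ∈ spaceTimeSurface T Γ) : ∑ i, dx i (fun w => W w i) z = 0 := by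
  refine tendsto_nhds_unique (tendsto_finsetSum _ fun i _ =>
    tendsto_fderiv_velocity hNS hW hk hu hz i (EuclideanSpace.single i 1, 0))
    (tendsto_const_nhds.congr' ?_)
  filter_upwards [hNS, eventually_mem_thinDomain hz] with ε hS hε
    using (hS.divergence_free _ hz.1 _ hε).symm

theorem dx_divergence_eq_zero
    (hNS : ∀ᶠ ε in 𝓝[>] (0 : ℝ), IsNavierStokesSolution μ₀ T (thinDomain Γ ε) (u ε) (p ε))
    (hW : ContDiffAt ℝ 2 W z) {k : ℕ} (hk : 2 < k) (hu : IsRemainder T Γ k fun ε z => u ε z - W z)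
    (hz : z ∈ spaceTimeSurface T Γ) (j : Fin 3) :
    ∑ i, dx j (dx i fun w => W w i) z = 0 := by
  refine tendsto_nhds_unique (tendsto_finsetSum _ fun i _ =>
    tendsto_dx_dx_velocity hNS hW hk hu hz i j i) (tendsto_const_nhds.congr' ?_)
  filter_upwards [hNS, eventually_contDiffAt_velocity hNS hz, eventually_mem_thinDomain hz]
    with ε hS huC hε
  have hd : ∀ i, DifferentiableAt ℝ (dx i fun w => u ε w i) z := fun i =>
    (contDiffAt_dx (contDiffAt_euclidean.mp huC i) i).differentiableAt one_ne_zero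
  have hdiv : ∀ᶠ x in 𝓝 z.1, ∑ i, dx i (fun w => u ε w i) (x, z.2) = 0 := by
    filter_upwards [Metric.isOpen_thickening.mem_nhds hε] with x hx
      using hS.divergence_free _ hz.1 _ hx
  have hgrad := dx_eq_zero_of_eventually (.fun_sum fun i _ => hd i) hdiv j
  rw [dx, fderiv_fun_sum fun i _ => hd i] at hgrad
  simpa [dx] using hgrad.symm

theorem limit_momentum
    (hNS : ∀ᶠ ε in 𝓝[>] (0 : ℝ), IsNavierStokesSolution μ₀ T (thinDomain Γ ε) (u ε) (p ε))
    (hW : ContDiffAt ℝ 2 W z) (hQ : ContDiffAt ℝ 1 Q z) {k l : ℕ} (hk : 2 < k) (hl : 1 < l)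
    (hu : IsRemainder T Γ k fun ε z => u ε z - W z)
    (hp : IsRemainder T Γ l fun ε z => p ε z - Q z) (hz : z ∈ spaceTimeSurface T Γ) (j : Fin 3) :
    fderiv ℝ (fun w => W w j) z (W z, 1) + dx j Q z = μ₀ * ∑ i, dx i (dx i fun w => W w j) z := by
  have hpC : ∀ᶠ ε in 𝓝[>] (0 : ℝ), ContDiffAt ℝ 1 (p ε) z := by
    filter_upwards [hNS, eventually_mem_closure_thinDomain hz] with ε hS hε
      using hS.contDiffAt_pressure _ hz.1 _ hε
  have hvelocity : ∀ i, Tendsto (fun ε => u ε z i) (𝓝[>] 0) (𝓝 (W z i)) := fun i =>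
    ((EuclideanSpace.proj (𝕜 := ℝ) i).continuous.tendsto _).comp
      (hu.tendsto_apply (by lia) hz)
  have hgradient := tendsto_fderiv_velocity hNS hW (by lia) hu hz j
  have hadvection := tendsto_finsetSum Finset.univ fun i _ =>
    (hvelocity i).mul (hgradient (EuclideanSpace.single i 1, 0))
  have hpressure := hp.tendsto_fderiv hl hz hpC hQ (EuclideanSpace.single j 1, 0)
  have hviscous := (tendsto_finsetSum Finset.univ fun i _ =>
    tendsto_dx_dx_velocity hNS hW hk hu hz j i i).const_mul μ₀
  have hlimit := tendsto_nhds_unique_of_eventuallyEq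
    (((hgradient (0, 1)).add hadvection).add hpressure) hviscous (by
      filter_upwards [hNS, eventually_mem_thinDomain hz] with ε hS hε
        using hS.momentum _ hz.1 _ hε j)
  rw [← hlimit, fderiv_apply_eq_sum]
  simp only [smul_eq_mul, dx, dt]
  ring

end ThinLimit

/-! ### Surface operators of a velocity without normal strain -/

namespace IsMovingClosedSurface

variable {v W : E3 × ℝ → E3}

theorem proj_mul_proj (hΓ : IsMovingClosedSurface T Γ ν V) (hz : z ∈ spaceTimeSurface T Γ) :
    proj ν z * proj ν z = proj ν z := by
  have hνν : (ν z).ofLp ⬝ᵥ (ν z).ofLp = 1 := by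
    rw [← hΓ.inner_normal_self hz, EuclideanSpace.inner_eq_star_dotProduct, star_trivial]
  have hPν : proj ν z *ᵥ (ν z).ofLp = 0 := by rw [proj_mulVec, hνν, one_smul, sub_self]
  nth_rw 2 [proj]
  rw [mul_sub, mul_one, Matrix.mul_vecMulVec, hPν, Matrix.zero_vecMulVec, sub_zero]

theorem surfGradMat_eq (hΓ : IsMovingClosedSurface T Γ ν V) (hz : z ∈ spaceTimeSurface T Γ)
    (hW : DifferentiableAt ℝ W z) (hWv : EqOn W v (spaceTimeSurface T Γ)) :
    surfGradMat Γ ν v z = proj ν z * gradMat W z := by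
  ext i j
  have hWj : DifferentiableAt ℝ (fun w => W w j) z := differentiableAt_euclidean.mp hW j
  rw [surfGradMat, Matrix.of_apply, hΓ.tanD_eq hz hWj fun w hw => congrArg (· j) (hWv hw),
    fderiv_apply_eq_sum, proj, sub_mul, one_mul, Matrix.vecMulVec_mul]
  simp [gradMat, Matrix.vecMulVec_apply, Matrix.vecMul, dotProduct]

theorem proj_mul_tanStrain_mul_proj (hΓ : IsMovingClosedSurface T Γ ν V)
    (hz : z ∈ spaceTimeSurface T Γ) (hW : DifferentiableAt ℝ W z)
    (hWv : EqOn W v (spaceTimeSurface T Γ)) :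
    proj ν z * tanStrain Γ ν v z * proj ν z = proj ν z * strain W z * proj ν z := by
  have hleft : proj ν z * (proj ν z * gradMat W z) = proj ν z * gradMat W z := by
    rw [← mul_assoc, hΓ.proj_mul_proj hz]
  have hright : (gradMat W z)ᵀ * proj ν z * proj ν z = (gradMat W z)ᵀ * proj ν z := by
    rw [mul_assoc, hΓ.proj_mul_proj hz]
  simp only [tanStrain, strain, hΓ.surfGradMat_eq hz hW hWv, Matrix.transpose_mul, transpose_proj,
    Matrix.mul_smul, Matrix.smul_mul, mul_add, add_mul, hleft]
  rw [mul_assoc (proj ν z) (_ * _) (proj ν z), hright, mul_assoc (proj ν z) _ᵀ]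

theorem strain_eq_proj_mul_tanStrain_mul_proj (hΓ : IsMovingClosedSurface T Γ ν V)
    (hz : z ∈ spaceTimeSurface T Γ) (hW : DifferentiableAt ℝ W z)
    (hWv : EqOn W v (spaceTimeSurface T Γ)) (hν : strain W z *ᵥ (ν z).ofLp = 0) :
    strain W z = proj ν z * tanStrain Γ ν v z * proj ν z := by
  have hν' : (ν z).ofLp ᵥ* strain W z = 0 := by
    rw [← transpose_strain, Matrix.vecMul_transpose, hν]
  rw [hΓ.proj_mul_tanStrain_mul_proj hz hW hWv, proj, sub_mul, one_mul, Matrix.vecMulVec_mul, hν',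
    Matrix.vecMulVec_zero, sub_zero, mul_sub, mul_one, Matrix.mul_vecMulVec, hν,
    Matrix.zero_vecMulVec, sub_zero]

theorem surfDiv_eq (hΓ : IsMovingClosedSurface T Γ ν V) (hz : z ∈ spaceTimeSurface T Γ)
    (hW : DifferentiableAt ℝ W z) (hWv : EqOn W v (spaceTimeSurface T Γ)) :
    surfDiv Γ ν v z =
      ∑ i, dx i (fun w => W w i) z - (ν z).ofLp ⬝ᵥ strain W z *ᵥ (ν z).ofLp := by
  have htan : ∀ i, tanD Γ ν i (fun w => v w i) z =
      dx i (fun w => W w i) z - ν z i * fderiv ℝ W z (ν z, 0) i := fun i => by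
    rw [hΓ.tanD_eq hz (differentiableAt_euclidean.mp hW i) fun w hw => congrArg (· i) (hWv hw),
      fderiv_component hW]
  simp only [surfDiv, htan, Finset.sum_sub_distrib, dotProduct_strain_mulVec hW, PiLp.inner_apply,
    RCLike.inner_apply, conj_trivial]

theorem surfDivMat_strain_eq (hΓ : IsMovingClosedSurface T Γ ν V)
    {M : E3 × ℝ → Matrix (Fin 3) (Fin 3) ℝ} (hz : z ∈ spaceTimeSurface T Γ)
    (hW : ContDiffAt ℝ 2 W z) (hWM : EqOn (strain W) M (spaceTimeSurface T Γ))
    (hν : fderiv ℝ (fun w => strain W w *ᵥ (ν z).ofLp) z (ν z, 0) = 0) (j : Fin 3) :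
    surfDivMat Γ ν M j z = (1 / 2 : ℝ) * (∑ i, dx i (dx i fun w => W w j) z +
      ∑ i, dx j (dx i fun w => W w i) z) := by
  have hd : ∀ a b, DifferentiableAt ℝ (fun w => strain W w a b) z := fun a b =>
    (contDiffAt_strain_apply hW a b).differentiableAt one_ne_zero
  have hnormal : ∑ i, ν z i * fderiv ℝ (fun w => strain W w i j) z (ν z, 0) = 0 := by
    have hrow : ∀ a, DifferentiableAt ℝ (fun w => (strain W w *ᵥ (ν z).ofLp) a) z := fun a => by
      simp only [Matrix.mulVec, dotProduct]
      exact .fun_sum fun b _ => (hd a b).mul_const _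
    rw [fderiv_pi hrow] at hν
    have hj : fderiv ℝ (fun w => ∑ i, strain W w j i * ν z i) z (ν z, 0) = 0 := congrFun hν j
    rw [fderiv_fun_sum fun i _ => (hd j i).mul_const _] at hj
    simpa [fderiv_mul_const, hd, fun w => Matrix.IsSymm.apply (transpose_strain W w) j] using hj
  rw [surfDivMat, Finset.sum_congr rfl fun i _ =>
    hΓ.tanD_eq hz (hd i j) (fun w hw => congrFun₂ (hWM hw) i j) i, Finset.sum_sub_distrib, hnormal,
    sub_zero]
  simp only [dx_strain_apply hW, ← Finset.mul_sum, Finset.sum_add_distrib]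
  congr 2
  exact Finset.sum_congr rfl fun i _ => dx_dx_comm (contDiffAt_euclidean.mp hW i) i j

/-! ### Expansions in the signed distance -/

section Expansion

variable {F : Type*} [NormedAddCommGroup F] [NormedSpace ℝ F] {f f₁ f₂ : E3 × ℝ → F}

theorem contDiffAt_normalExt_of_mem (hΓ : IsMovingClosedSurface T Γ ν V)
    (hz : z ∈ spaceTimeSurface T Γ) (hf : SmoothOnSurface T Γ f) :
    ContDiffAt ℝ ∞ (normalExt Γ f) z :=
  hΓ.contDiffAt_normalExt hz.1 (hΓ.eventually_contDiffAt_closestPointMap hz).self_of_nhds hf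

theorem contDiffAt_signedDist_of_mem (hΓ : IsMovingClosedSurface T Γ ν V)
    (hz : z ∈ spaceTimeSurface T Γ) : ContDiffAt ℝ ∞ (signedDist Γ ν) z :=
  hΓ.contDiffAt_signedDist hz.1 (hΓ.eventually_contDiffAt_closestPointMap hz).self_of_nhds

theorem contDiffAt_linearExpansion (hΓ : IsMovingClosedSurface T Γ ν V)
    (hz : z ∈ spaceTimeSurface T Γ) (hf : SmoothOnSurface T Γ f) (hf₁ : SmoothOnSurface T Γ f₁) :
    ContDiffAt ℝ ∞ (fun w => normalExt Γ f w + signedDist Γ ν w • normalExt Γ f₁ w) z :=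
  (hΓ.contDiffAt_normalExt_of_mem hz hf).add
    ((hΓ.contDiffAt_signedDist_of_mem hz).smul (hΓ.contDiffAt_normalExt_of_mem hz hf₁))

theorem contDiffAt_quadraticExpansion (hΓ : IsMovingClosedSurface T Γ ν V)
    (hz : z ∈ spaceTimeSurface T Γ) (hf : SmoothOnSurface T Γ f) (hf₁ : SmoothOnSurface T Γ f₁)
    (hf₂ : SmoothOnSurface T Γ f₂) :
    ContDiffAt ℝ ∞ (fun w => normalExt Γ f w + signedDist Γ ν w • normalExt Γ f₁ w +
      signedDist Γ ν w ^ 2 • normalExt Γ f₂ w) z :=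
  (hΓ.contDiffAt_linearExpansion hz hf hf₁).add
    (((hΓ.contDiffAt_signedDist_of_mem hz).pow 2).smul (hΓ.contDiffAt_normalExt_of_mem hz hf₂))

theorem linearExpansion_eqOn (hΓ : IsMovingClosedSurface T Γ ν V) (f f₁ : E3 × ℝ → F) :
    EqOn (fun w => normalExt Γ f w + signedDist Γ ν w • normalExt Γ f₁ w) f
      (spaceTimeSurface T Γ) := fun z hz => by
  simp [hΓ.signedDist_of_mem hz, normalExt_of_mem f hz]

theorem quadraticExpansion_eqOn (hΓ : IsMovingClosedSurface T Γ ν V) (f f₁ f₂ : E3 × ℝ → F) :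
    EqOn (fun w => normalExt Γ f w + signedDist Γ ν w • normalExt Γ f₁ w +
      signedDist Γ ν w ^ 2 • normalExt Γ f₂ w) f (spaceTimeSurface T Γ) := fun z hz => by
  simp [hΓ.signedDist_of_mem hz, normalExt_of_mem f hz]

theorem fderiv_normalExt_normal (hΓ : IsMovingClosedSurface T Γ ν V)
    (hz : z ∈ spaceTimeSurface T Γ) (hf : DifferentiableAt ℝ (normalExt Γ f) z) :
    fderiv ℝ (normalExt Γ f) z (ν z, 0) = 0 := by
  rw [hΓ.fderiv_normalExt hz hf fun w hw => normalExt_of_mem f hw, hΓ.inner_normal_self hz]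
  simp [Prod.mk_zero_zero]

theorem fderiv_linearExpansion_normal (hΓ : IsMovingClosedSurface T Γ ν V)
    (hz : z ∈ spaceTimeSurface T Γ) (hf : SmoothOnSurface T Γ f) (hf₁ : SmoothOnSurface T Γ f₁) :
    fderiv ℝ (fun w => normalExt Γ f w + signedDist Γ ν w • normalExt Γ f₁ w) z (ν z, 0) =
      f₁ z := by
  have hπ := (hΓ.eventually_contDiffAt_closestPointMap hz).self_of_nhds
  have hd := (hΓ.contDiffAt_signedDist_of_mem hz).differentiableAt (by simp)
  have hdf := (hΓ.contDiffAt_normalExt_of_mem hz hf).differentiableAt (by simp)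
  have hdf₁ := (hΓ.contDiffAt_normalExt_of_mem hz hf₁).differentiableAt (by simp)
  have hderiv : fderiv ℝ (signedDist Γ ν) z (ν z, 0) = 1 := by
    rw [hΓ.fderiv_signedDist hz.1 hπ, normalExt_of_mem ν hz, hΓ.inner_normal_self hz, mul_zero,
      sub_zero]
  rw [fderiv_fun_add hdf (hd.fun_smul hdf₁), fderiv_fun_smul hd hdf₁]
  simp [hΓ.fderiv_normalExt_normal hz hdf, hderiv, hΓ.signedDist_of_mem hz, normalExt_of_mem f₁ hz]

end Expansion

/-! ### The limit system on the surface -/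

section LimitSystem

variable {μ₀ : ℝ} {u : ℝ → E3 × ℝ → E3} {p : ℝ → E3 × ℝ → ℝ} {v W : E3 × ℝ → E3}
  {q q₁ Q : E3 × ℝ → ℝ}

theorem surfDiv_eq_zero (hΓ : IsMovingClosedSurface T Γ ν V)
    (hNS : ∀ᶠ ε in 𝓝[>] (0 : ℝ), IsNavierStokesSolution μ₀ T (thinDomain Γ ε) (u ε) (p ε))
    (hW : ContDiffAt ℝ 2 W z) (hWv : EqOn W v (spaceTimeSurface T Γ))
    (hu : IsRemainder T Γ 3 fun ε z => u ε z - W z) (hz : z ∈ spaceTimeSurface T Γ) :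
    surfDiv Γ ν v z = 0 := by
  rw [hΓ.surfDiv_eq hz (hW.differentiableAt two_ne_zero) hWv,
    divergence_eq_zero hNS hW (by norm_num) hu hz,
    (inner_normal_eq_and_normal_strain_eq_zero hΓ hNS hW hu hz).2.1, sub_zero]

theorem surfDivMat_tanStrain_eq (hΓ : IsMovingClosedSurface T Γ ν V)
    (hNS : ∀ᶠ ε in 𝓝[>] (0 : ℝ), IsNavierStokesSolution μ₀ T (thinDomain Γ ε) (u ε) (p ε))
    (hW : ∀ z ∈ spaceTimeSurface T Γ, ContDiffAt ℝ 2 W z) (hWv : EqOn W v (spaceTimeSurface T Γ))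
    (hu : IsRemainder T Γ 3 fun ε z => u ε z - W z) (hz : z ∈ spaceTimeSurface T Γ) (j : Fin 3) :
    surfDivMat Γ ν (fun w => proj ν w * tanStrain Γ ν v w * proj ν w) j z =
      (1 / 2 : ℝ) * ∑ i, dx i (dx i fun w => W w j) z := by
  have hstrain : EqOn (strain W) (fun w => proj ν w * tanStrain Γ ν v w * proj ν w)
      (spaceTimeSurface T Γ) := fun w hw =>
    hΓ.strain_eq_proj_mul_tanStrain_mul_proj hw ((hW w hw).differentiableAt two_ne_zero) hWv
      (strain_mulVec_normal_eq_zero hΓ hNS (hW w hw) hu hw).1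
  rw [hΓ.surfDivMat_strain_eq hz (hW z hz) hstrain
    (strain_mulVec_normal_eq_zero hΓ hNS (hW z hz) hu hz).2,
    dx_divergence_eq_zero hNS (hW z hz) (by norm_num) hu hz, add_zero]

theorem surface_momentum (hΓ : IsMovingClosedSurface T Γ ν V)
    (hNS : ∀ᶠ ε in 𝓝[>] (0 : ℝ), IsNavierStokesSolution μ₀ T (thinDomain Γ ε) (u ε) (p ε))
    (hW : ∀ z ∈ spaceTimeSurface T Γ, ContDiffAt ℝ 2 W z) (hWv : EqOn W v (spaceTimeSurface T Γ))
    (hQ : ContDiffAt ℝ 1 Q z) (hQq : EqOn Q q (spaceTimeSurface T Γ))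
    (hQq₁ : fderiv ℝ Q z (ν z, 0) = q₁ z) (hu : IsRemainder T Γ 3 fun ε z => u ε z - W z)
    (hp : IsRemainder T Γ 2 fun ε z => p ε z - Q z) (hz : z ∈ spaceTimeSurface T Γ) (j : Fin 3) :
    materialDeriv Γ v (fun w => v w j) z + tanD Γ ν j q z + q₁ z * ν z j =
      2 * μ₀ * surfDivMat Γ ν (fun w => proj ν w * tanStrain Γ ν v w * proj ν w) j z := by
  have hvν : inner ℝ (v z) (ν z) = V z :=
    hWv hz ▸ (inner_normal_eq_and_normal_strain_eq_zero hΓ hNS (hW z hz) hu hz).1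
  have hWj : DifferentiableAt ℝ (fun w => W w j) z :=
    differentiableAt_euclidean.mp ((hW z hz).differentiableAt two_ne_zero) j
  rw [hΓ.surfDivMat_tanStrain_eq hNS hW hWv hu hz,
    hΓ.materialDeriv_eq hz hWj (fun w hw => congrArg (· j) (hWv hw)) hvν,
    hΓ.tanD_eq hz (hQ.differentiableAt one_ne_zero) hQq, hQq₁, ← hWv hz]
  linear_combination limit_momentum hNS (hW z hz) hQ (by norm_num) (by norm_num) hu hp hz j

end LimitSystem

end IsMovingClosedSurface

end ThinNS

theorem theorem4p1_general {T μ₀ : ℝ} {Γ : ℝ → Set E3} {ν : E3 × ℝ → E3} {V : E3 × ℝ → ℝ}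
    (hΓ : IsMovingClosedSurface T Γ ν V) {u : ℝ → E3 × ℝ → E3} {p : ℝ → E3 × ℝ → ℝ}
    (hNS : ∀ᶠ ε in 𝓝[>] (0 : ℝ), IsNavierStokesSolution μ₀ T (thinDomain Γ ε) (u ε) (p ε))
    {v W : E3 × ℝ → E3} {q q₁ Q : E3 × ℝ → ℝ}
    (hW : ∀ z ∈ spaceTimeSurface T Γ, ContDiffAt ℝ 2 W z)
    (hQ : ∀ z ∈ spaceTimeSurface T Γ, ContDiffAt ℝ 1 Q z)
    (hWv : EqOn W v (spaceTimeSurface T Γ)) (hQq : EqOn Q q (spaceTimeSurface T Γ))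
    (hQq₁ : ∀ z ∈ spaceTimeSurface T Γ, fderiv ℝ Q z (ν z, 0) = q₁ z)
    (hu : IsRemainder T Γ 3 fun ε z => u ε z - W z)
    (hp : IsRemainder T Γ 2 fun ε z => p ε z - Q z) :
    (∀ z ∈ spaceTimeSurface T Γ, inner ℝ (v z) (ν z) = V z) ∧
    (∀ z ∈ spaceTimeSurface T Γ, ∀ j : Fin 3,
      materialDeriv Γ v (fun w => v w j) z + tanD Γ ν j q z + q₁ z * ν z j =
        2 * μ₀ * surfDivMat Γ ν (fun w => proj ν w * tanStrain Γ ν v w * proj ν w) j z) ∧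
    (∀ z ∈ spaceTimeSurface T Γ, surfDiv Γ ν v z = 0) := by
  refine ⟨fun z hz => ?_, fun z hz j => ?_, fun z hz => ?_⟩
  · exact hWv hz ▸ (inner_normal_eq_and_normal_strain_eq_zero hΓ hNS (hW z hz) hu hz).1
  · exact hΓ.surface_momentum hNS hW hWv (hQ z hz) hQq (hQq₁ z hz) hu hp hz j
  · exact hΓ.surfDiv_eq_zero hNS (hW z hz) hWv hu hz

theorem theorem4p1 (T μ₀ : ℝ) (hT : 0 < T) (hμ₀ : 0 < μ₀)
    (Γ : ℝ → Set E3) (ν : E3 × ℝ → E3) (V : E3 × ℝ → ℝ)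
    (hΓ : IsMovingClosedSurface T Γ ν V)
    (u : ℝ → E3 × ℝ → E3) (p : ℝ → E3 × ℝ → ℝ)
    (hNS : ∀ᶠ ε in 𝓝[>] (0 : ℝ), IsNavierStokesSolution μ₀ T (thinDomain Γ ε) (u ε) (p ε))
    (v v1 v2 : E3 × ℝ → E3) (q q1 : E3 × ℝ → ℝ)
    (hv : SmoothOnSurface T Γ v) (hv1 : SmoothOnSurface T Γ v1) (hv2 : SmoothOnSurface T Γ v2)
    (hq : SmoothOnSurface T Γ q) (hq1 : SmoothOnSurface T Γ q1)
    (hu : IsRemainder T Γ 3 fun ε z => u ε z - (normalExt Γ v z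
      + signedDist Γ ν z • normalExt Γ v1 z + signedDist Γ ν z ^ 2 • normalExt Γ v2 z))
    (hp : IsRemainder T Γ 2 fun ε z => p ε z - (normalExt Γ q z
      + signedDist Γ ν z * normalExt Γ q1 z)) :
    (∀ z ∈ spaceTimeSurface T Γ, inner ℝ (v z) (ν z) = V z) ∧
    (∀ z ∈ spaceTimeSurface T Γ, ∀ j : Fin 3,
      materialDeriv Γ v (fun w => v w j) z + tanD Γ ν j q z + q1 z * ν z j =
        2 * μ₀ * surfDivMat Γ ν (fun w => proj ν w * tanStrain Γ ν v w * proj ν w) j z) ∧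
    (∀ z ∈ spaceTimeSurface T Γ, surfDiv Γ ν v z = 0) := by
  exact theorem4p1_general hΓ hNS
    (fun z hz => contDiffAt_infty.mp (hΓ.contDiffAt_quadraticExpansion hz hv hv1 hv2) 2)
    (fun z hz => contDiffAt_infty.mp (hΓ.contDiffAt_linearExpansion hz hq hq1) 1)
    (hΓ.quadraticExpansion_eqOn v v1 v2) (hΓ.linearExpansion_eqOn q q1)
    (fun z hz => hΓ.fderiv_linearExpansion_normal hz hq hq1) hu hp
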